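/- Let $(M,g)$ be a smooth Lorentzian manifold of dimension $n>3$ with signature $(-,+,\dots,+)$ that is a twisted space-time: it carries a smooth unit time-like vector field $u$ and a smooth scalar field $\varphi$ such that $$u^iu_i=-1,\qquad \nabla_i u_j=\varphi\,(g_{ij}+u_iu_j),$$ where $\nabla$ is the Levi-Civita connection. Let $C_{jklm}$ be the Weyl tensor, with all indices lowered, and let $E_{kl}=u^ju^mC_{jklm}$ be its electric part. Then, in every coordinate system and for all values of the free indices, $$\begin{aligned} \nabla_p C_{ikm}{}^p={}&(n-3)(\nabla_iE_{km}-\nabla_kE_{im})\\ &+(n-2)\big[u^p\nabla_p(u_iE_{km}-u_kE_{im})+2\varphi(u_iE_{km}-u_kE_{im})\big]\\ &+(2u_ku_m+g_{km})\nabla_pE_i{}^p-(2u_iu_m+g_{im})\nabla_pE_k{}^p \end{aligned}$$ and $$\begin{aligned} (n-3)\big(u^p\nabla_pC_{iklm}+2\varphi C_{iklm}\big) ={}&(n-2)\big[u^p\nabla_p A_{iklm}+2\varphi A_{iklm}\big]+\big[u^p\nabla_p B_{iklm}+2\varphi B_{iklm}\big], \end{aligned}$$ where $$A_{iklm}=u_iu_mE_{kl}-u_ku_mE_{il}-u_iu_lE_{km}+u_ku_lE_{im},$$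 $$B_{iklm}=g_{im}E_{kl}-g_{km}E_{il}-g_{il}E_{km}+g_{kl}E_{im}.$$ -/

import Mathlib

open scoped Manifold ContDiff Bundle

noncomputable section

attribute [local instance 2000] chartedSpaceSelf

/-- Coordinate space: an `n`-dimensional manifold has charts with values in it. -/
abbrev Coord (n : ℕ) : Type := EuclideanSpace ℝ (Fin n)

namespace CoordTensor

/-! Tensor calculus on coordinate components. A tensor field is given by its component functions
`T y i j …` at the point with coordinates `y`; all tensors below have lower indices unless the
index is said to be an upper one. -/

variable {n : ℕ}

/-- The partial derivative `∂ᵢ f`. -/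
def pd (i : Fin n) (f : Coord n → ℝ) (y : Coord n) : ℝ :=
  fderiv ℝ f y (EuclideanSpace.single i 1)

/-- Christoffel symbols of the second kind:
`Γᵏᵢⱼ = ½ gᵏˡ (∂ᵢ gⱼₗ + ∂ⱼ gᵢₗ - ∂ₗ gᵢⱼ)`, written `christoffel g y k i j`. -/
def christoffel (g : Coord n → Matrix (Fin n) (Fin n) ℝ) (y : Coord n) (k i j : Fin n) : ℝ :=
  (1 / 2) * ∑ l, (g y)⁻¹ k l *
    (pd i (fun z => g z j l) y + pd j (fun z => g z i l) y - pd l (fun z => g z i j) y)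

/-- `∇ᵢ Tₐ`, the index of the derivative coming first. -/
def covD1 (g : Coord n → Matrix (Fin n) (Fin n) ℝ) (T : Coord n → Fin n → ℝ)
    (y : Coord n) (i a : Fin n) : ℝ :=
  pd i (fun z => T z a) y - ∑ p, christoffel g y p i a * T y p

/-- `∇ᵢ Tₐᵦ`, the index of the derivative coming first. -/
def covD2 (g : Coord n → Matrix (Fin n) (Fin n) ℝ) (T : Coord n → Fin n → Fin n → ℝ)
    (y : Coord n) (i a b : Fin n) : ℝ :=
  pd i (fun z => T z a b) y
    - ∑ p, christoffel g y p i a * T y p b - ∑ p, christoffel g y p i b * T y a p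

/-- `∇ᵢ T` for a tensor with three lower indices. -/
def covD3 (g : Coord n → Matrix (Fin n) (Fin n) ℝ) (T : Coord n → Fin n → Fin n → Fin n → ℝ)
    (y : Coord n) (i a b c : Fin n) : ℝ :=
  pd i (fun z => T z a b c) y
    - ∑ p, christoffel g y p i a * T y p b c - ∑ p, christoffel g y p i b * T y a p c
    - ∑ p, christoffel g y p i c * T y a b p

/-- `∇ᵢ T` for a tensor with four lower indices. -/
def covD4 (g : Coord n → Matrix (Fin n) (Fin n) ℝ)
    (T : Coord n → Fin n → Fin n → Fin n → Fin n → ℝ)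
    (y : Coord n) (i a b c d : Fin n) : ℝ :=
  pd i (fun z => T z a b c d) y
    - ∑ p, christoffel g y p i a * T y p b c d - ∑ p, christoffel g y p i b * T y a p c d
    - ∑ p, christoffel g y p i c * T y a b p d - ∑ p, christoffel g y p i d * T y a b c p

/-- `∇ₚ Tₐᵖ`, the divergence on the (raised) last index of a tensor with two lower indices. -/
def div2 (g : Coord n → Matrix (Fin n) (Fin n) ℝ) (T : Coord n → Fin n → Fin n → ℝ)
    (y : Coord n) (a : Fin n) : ℝ :=
  ∑ p, ∑ q, (g y)⁻¹ p q * covD2 g T y p a q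

/-- `∇ₚ T_{abc}{}^p`, the divergence on the (raised) last index of a tensor with four lower indices. -/
def div4 (g : Coord n → Matrix (Fin n) (Fin n) ℝ)
    (T : Coord n → Fin n → Fin n → Fin n → Fin n → ℝ) (y : Coord n) (a b c : Fin n) : ℝ :=
  ∑ p, ∑ q, (g y)⁻¹ p q * covD4 g T y p a b c q

/-- `uᵖ ∇ₚ T` for a tensor with three lower indices (`u` has an upper index). -/
def dirD3 (g : Coord n → Matrix (Fin n) (Fin n) ℝ) (u : Coord n → Fin n → ℝ)
    (T : Coord n → Fin n → Fin n → Fin n → ℝ) (y : Coord n) (a b c : Fin n) : ℝ :=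
  ∑ p, u y p * covD3 g T y p a b c

/-- `uᵖ ∇ₚ T` for a tensor with four lower indices (`u` has an upper index). -/
def dirD4 (g : Coord n → Matrix (Fin n) (Fin n) ℝ) (u : Coord n → Fin n → ℝ)
    (T : Coord n → Fin n → Fin n → Fin n → Fin n → ℝ) (y : Coord n) (a b c d : Fin n) : ℝ :=
  ∑ p, u y p * covD4 g T y p a b c d

/-- Lowering the index of a vector field: `uᵢ = gᵢⱼ uʲ`. -/
def lower (g : Coord n → Matrix (Fin n) (Fin n) ℝ) (u : Coord n → Fin n → ℝ)
    (y : Coord n) (i : Fin n) : ℝ :=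
  ∑ j, g y i j * u y j

/-- The curvature `Rᵢⱼₖᵐ` (last index upper), normalized by
`∇ᵢ ∇ⱼ wₖ - ∇ⱼ ∇ᵢ wₖ = Rᵢⱼₖᵐ wₘ`. -/
def riemannUp (g : Coord n → Matrix (Fin n) (Fin n) ℝ) (y : Coord n) (i j k m : Fin n) : ℝ :=
  pd j (fun z => christoffel g z m i k) y - pd i (fun z => christoffel g z m j k) y
    + ∑ p, (christoffel g y m j p * christoffel g y p i k
      - christoffel g y m i p * christoffel g y p j k)

/-- The Riemann tensor `Rᵢⱼₖₘ`. -/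
def riemann (g : Coord n → Matrix (Fin n) (Fin n) ℝ) (y : Coord n) (i j k m : Fin n) : ℝ :=
  ∑ p, riemannUp g y i j k p * g y p m

/-- The Ricci tensor `Rⱼₘ = gⁱᵏ Rᵢⱼₖₘ`. -/
def ricci (g : Coord n → Matrix (Fin n) (Fin n) ℝ) (y : Coord n) (j m : Fin n) : ℝ :=
  ∑ i, ∑ k, (g y)⁻¹ i k * riemann g y i j k m

/-- The scalar curvature. -/
def scalar (g : Coord n → Matrix (Fin n) (Fin n) ℝ) (y : Coord n) : ℝ :=
  ∑ j, ∑ m, (g y)⁻¹ j m * ricci g y j m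

/-- The Weyl conformal curvature tensor `Cⱼₖₗₘ`: the trace-free part of the Riemann tensor. -/
def weyl (g : Coord n → Matrix (Fin n) (Fin n) ℝ) (y : Coord n) (j k l m : Fin n) : ℝ :=
  riemann g y j k l m
    - (1 / ((n : ℝ) - 2)) *
      (g y j l * ricci g y k m - g y j m * ricci g y k l
        - g y k l * ricci g y j m + g y k m * ricci g y j l)
    + (scalar g y / (((n : ℝ) - 1) * ((n : ℝ) - 2))) *
      (g y j l * g y k m - g y j m * g y k l)

/-- The electric part `Eₖₗ = uʲ uᵐ Cⱼₖₗₘ` of the Weyl tensor (`u` has an upper index). -/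
def electric (g : Coord n → Matrix (Fin n) (Fin n) ℝ) (u : Coord n → Fin n → ℝ)
    (y : Coord n) (k l : Fin n) : ℝ :=
  ∑ j, ∑ m, u y j * u y m * weyl g y j k l m

/-- For symmetric `A`, `B`, the combination
`Aᵢₘ Bₖₗ - Aₖₘ Bᵢₗ - Aᵢₗ Bₖₘ + Aₖₗ Bᵢₘ` (indices in the order `i k l m`). -/
def kulkarniNomizu (A B : Coord n → Fin n → Fin n → ℝ) (y : Coord n) (i k l m : Fin n) : ℝ :=
  A y i m * B y k l - A y k m * B y i l - A y i l * B y k m + A y k l * B y i m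

end CoordTensor

section Manifolds

variable (n : ℕ) (M : Type*) [TopologicalSpace M] [ChartedSpace (Coord n) M]
  [IsManifold (𝓡 n) ∞ M]

/-- A smooth Lorentzian metric, of signature `(-, +, …, +)`: at every point there is a vector `t`
with `g(t, t) < 0` on whose orthogonal complement `g` is positive definite. -/
structure LorentzMetric where
  /-- The scalar product on each tangent space. -/
  inner (x : M) : TangentSpace (𝓡 n) x →L[ℝ] TangentSpace (𝓡 n) x →L[ℝ] ℝ
  symm (x : M) (v w : TangentSpace (𝓡 n) x) : inner x v w = inner x w v
  lorentzian (x : M) : ∃ t : TangentSpace (𝓡 n) x, inner x t t < 0 ∧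
    ∀ v : TangentSpace (𝓡 n) x, inner x t v = 0 → v ≠ 0 → 0 < inner x v v
  contMDiff : ContMDiff (𝓡 n) ((𝓡 n).prod 𝓘(ℝ, Coord n →L[ℝ] Coord n →L[ℝ] ℝ)) ∞
    (fun x => Bundle.TotalSpace.mk' (Coord n →L[ℝ] Coord n →L[ℝ] ℝ)
      (E := fun x : M => TangentSpace (𝓡 n) x →L[ℝ] TangentSpace (𝓡 n) x →L[ℝ] ℝ)
      x (inner x))

variable {n M}

/-- The coordinate vector `∂ᵢ` of the chart `e` at the point with coordinates `y`. -/
def coordVec (e : OpenPartialHomeomorph M (Coord n)) (y : Coord n) (i : Fin n) :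
    TangentSpace (𝓡 n) (e.symm y) :=
  mfderiv (𝓡 n) (𝓡 n) e.symm y (EuclideanSpace.single i 1 : Coord n)

/-- The components `gᵢⱼ` of a metric in the chart `e`. -/
def LorentzMetric.comp (g : LorentzMetric n M) (e : OpenPartialHomeomorph M (Coord n))
    (y : Coord n) : Matrix (Fin n) (Fin n) ℝ :=
  Matrix.of fun i j => g.inner (e.symm y) (coordVec e y i) (coordVec e y j)

/-- The components `uⁱ` of a vector field in the chart `e`. -/
def vecComp (u : (x : M) → TangentSpace (𝓡 n) x) (e : OpenPartialHomeomorph M (Coord n))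
    (y : Coord n) (i : Fin n) : ℝ :=
  (show Coord n from mfderiv (𝓡 n) (𝓡 n) e (e.symm y) (u (e.symm y))) i

open CoordTensor in
/-- `(M, g)` is a twisted space-time with velocity field `u` and scalar field `φ`: `u` is a smooth
unit time-like vector field, `φ` is smooth, and `∇ᵢ uⱼ = φ (gᵢⱼ + uᵢ uⱼ)` in all coordinates. -/
structure IsTwisted (g : LorentzMetric n M) (u : (x : M) → TangentSpace (𝓡 n) x)
    (φ : M → ℝ) : Prop where
  smooth_velocity : ContMDiff (𝓡 n) (𝓡 n).tangent ∞
    (fun x => (⟨x, u x⟩ : TangentBundle (𝓡 n) M))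
  smooth_scalar : ContMDiff (𝓡 n) 𝓘(ℝ) ∞ φ
  unit (x : M) : g.inner x (u x) (u x) = -1
  torse_forming : ∀ e ∈ IsManifold.maximalAtlas (𝓡 n) ∞ M, ∀ y ∈ e.target, ∀ i j : Fin n,
    covD1 (g.comp e) (lower (g.comp e) (vecComp u e)) y i j =
      φ (e.symm y) * (g.comp e y i j +
        lower (g.comp e) (vecComp u e) y i * lower (g.comp e) (vecComp u e) y j)

end Manifolds

end

/-! In a chart all components are smooth functions, so both identities become identities in a
commutative ℝ-algebra `R` with commuting derivations. The tensor calculus is done in such an `R`;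
`smoothRing` provides the instance that is needed.

The Ricci identity for the torse-forming covector `w` determines the contraction of the Riemann
tensor with `u` (`IsTorseForming.dot_curv`). Write `C` as Riemann plus a Kulkarni–Nomizu product of
`g` with a Schouten tensor `P`. Since `C` is trace-free, the unknown part of `P` drops out and the
magnetic part vanishes: uᵐCⱼₖₗₘ = wₖEⱼₗ - wⱼEₖₗ (`IsTorseForming.dot_weyl`). Differentiating this
expresses every contraction of `u` into a tensor slot of ∇C through `E`, ∇E and `C` (`dot_cov_weyl`,
`dot_cov_weyl'`).

The other input is the second Bianchi identity of the Weyl tensor. Multiplied by n - 3, its right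
side involves only `g` and the divergence of `C` (`weyl_bianchi_div`). Contracting it with `u` in
the last slot and then in the first tensor slot isolates one divergence, because uʲwⱼ = -1; this is
`div_weyl`. Contracting it with `u` in the derivative slot instead produces uᵖ∇ₚC, and the one
divergence left uncontracted is replaced by `div_weyl`; this is `dot_cov4_electric`. Finally uᵖ∇ₚ
passes through `w` and `g`, since `u` is geodesic and `g` is parallel. -/

namespace IndexCalculus

/-! ### Contractions and traces of arrays over a commutative ring. -/

section Contraction

variable {ι R : Type*} [Fintype ι] [CommRing R]

/-- The contraction `vᵖ Xₚ`. -/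
def dot (v X : ι → R) : R := ∑ p, v p * X p

/-- The contraction `hᵖᑫ Tₚᑫ`. -/
def tr (h T : ι → ι → R) : R := ∑ p, dot (h p) (T p)

lemma dot_comm (v X : ι → R) : dot v X = dot X v :=
  Finset.sum_congr rfl fun _ _ => mul_comm _ _

@[simp] lemma dot_add (v X Y : ι → R) : dot v (fun p => X p + Y p) = dot v X + dot v Y := by
  simp [dot, mul_add, Finset.sum_add_distrib]

@[simp] lemma dot_sub (v X Y : ι → R) : dot v (fun p => X p - Y p) = dot v X - dot v Y := by
  simp [dot, mul_sub, Finset.sum_sub_distrib]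

@[simp] lemma dot_neg (v X : ι → R) : dot v (fun p => -X p) = -dot v X := by
  simp [dot]

@[simp] lemma dot_mul_const (v X : ι → R) (c : R) : dot v (fun p => X p * c) = dot v X * c := by
  simp [dot, Finset.sum_mul, mul_assoc]

@[simp] lemma dot_const_mul (v X : ι → R) (c : R) : dot v (fun p => c * X p) = c * dot v X := by
  simp [dot, Finset.mul_sum, mul_left_comm]

@[simp] lemma dot_zero (v : ι → R) : dot v (fun _ => 0) = 0 := by
  simp [dot]

lemma dot_swap (v w : ι → R) (T : ι → ι → R) :
    dot v (fun a => dot w (T a)) = dot w (fun b => dot v fun a => T a b) := by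
  simp only [dot, Finset.mul_sum]
  rw [Finset.sum_comm]
  simp only [mul_left_comm]

lemma dot_dot (v X : ι → R) (T : ι → ι → R) :
    dot v (fun a => dot (T a) X) = dot (fun b => dot v fun a => T a b) X := by
  simp only [dot, Finset.mul_sum, Finset.sum_mul]
  rw [Finset.sum_comm]
  simp only [mul_assoc]

@[simp] lemma tr_add (h S T : ι → ι → R) :
    tr h (fun p q => S p q + T p q) = tr h S + tr h T := by
  simp [tr, Finset.sum_add_distrib]

@[simp] lemma tr_sub (h S T : ι → ι → R) :
    tr h (fun p q => S p q - T p q) = tr h S - tr h T := by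
  simp [tr, Finset.sum_sub_distrib]

@[simp] lemma tr_neg (h T : ι → ι → R) : tr h (fun p q => -T p q) = -tr h T := by
  simp [tr]

@[simp] lemma tr_mul_const (h T : ι → ι → R) (c : R) :
    tr h (fun p q => T p q * c) = tr h T * c := by
  simp [tr, Finset.sum_mul]

@[simp] lemma tr_const_mul (h T : ι → ι → R) (c : R) :
    tr h (fun p q => c * T p q) = c * tr h T := by
  simp [tr, Finset.mul_sum]

@[simp] lemma tr_zero (h : ι → ι → R) : tr h (fun _ _ => 0) = 0 := by
  simp [tr]

lemma tr_transpose {h : ι → ι → R} (hs : ∀ a b, h a b = h b a) (T : ι → ι → R) :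
    tr h (fun p q => T q p) = tr h T := by
  simp only [tr, dot]
  rw [Finset.sum_comm]
  simp only [hs]

lemma tr_dot (h : ι → ι → R) (v : ι → R) (T : ι → ι → ι → R) :
    tr h (fun p q => dot v (T p q)) = dot v (fun a => tr h fun p q => T p q a) := by
  simp only [tr]
  simp only [dot_swap _ v]
  simp only [dot, Finset.mul_sum]
  rw [Finset.sum_comm]

lemma tr_tr (h : ι → ι → R) (T : ι → ι → ι → ι → R) :
    tr h (fun p q => tr h (T p q)) = tr h (fun a b => tr h fun p q => T p q a b) := by
  simp only [tr, dot, Finset.mul_sum]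
  rw [Finset.sum_congr rfl fun p _ => Finset.sum_comm, Finset.sum_comm]
  refine Finset.sum_congr rfl fun a _ => ?_
  rw [Finset.sum_congr rfl fun p _ => Finset.sum_comm, Finset.sum_comm]
  refine Finset.sum_congr rfl fun b _ => Finset.sum_congr rfl fun p _ =>
    Finset.sum_congr rfl fun q _ => ?_
  ring

/-- A ring of smooth functions has zero divisors, so factors such as 2, n - 2 and 4 - 2n cannot be
cancelled merely for being nonzero; they are units because `R` is an ℝ-algebra. -/
lemma intCast_mul_cancel [Algebra ℝ R] {k : ℤ} (hk : k ≠ 0) {x : R} (hx : (k : R) * x = 0) :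
    x = 0 := by
  have h1 : IsUnit (algebraMap ℝ R (k : ℝ)) :=
    (IsUnit.mk0 (k : ℝ) (by exact_mod_cast hk)).map (algebraMap ℝ R)
  rw [map_intCast] at h1
  exact h1.mul_right_eq_zero.mp hx

lemma tr_antisymm [Algebra ℝ R] {h : ι → ι → R} (hs : ∀ a b, h a b = h b a) {T : ι → ι → R}
    (hT : ∀ a b, T a b = -T b a) : tr h T = 0 := by
  have h1 := tr_transpose hs T
  have h2 : tr h (fun p q => T q p) = -tr h T := by
    rw [← tr_neg]
    exact congrArg _ (funext₂ fun p q => by rw [hT])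
  refine intCast_mul_cancel (k := 2) (by norm_num) ?_
  push_cast
  linear_combination h2 - h1

end Contraction

/-! ### Covariant derivatives and the Levi-Civita connection. -/

section Covariant

variable {ι R : Type*} [Fintype ι] [CommRing R] [Algebra ℝ R]

/-- `∇ᵢ Tₐ`, where `Γ i a p` stands for `Γᵖᵢₐ`. -/
def cov1 (d : ι → Derivation ℝ R R) (Γ : ι → ι → ι → R) (T : ι → R) (i a : ι) : R :=
  d i (T a) - dot (Γ i a) T

/-- `∇ᵢ Tₐᵦ`. -/
def cov2 (d : ι → Derivation ℝ R R) (Γ : ι → ι → ι → R) (T : ι → ι → R) (i a b : ι) : R :=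
  d i (T a b) - dot (Γ i a) (fun p => T p b) - dot (Γ i b) (fun p => T a p)

/-- `∇ᵢ T` for a tensor with three lower indices. -/
def cov3 (d : ι → Derivation ℝ R R) (Γ : ι → ι → ι → R) (T : ι → ι → ι → R)
    (i a b c : ι) : R :=
  d i (T a b c) - dot (Γ i a) (fun p => T p b c) - dot (Γ i b) (fun p => T a p c)
    - dot (Γ i c) (fun p => T a b p)

/-- `∇ᵢ T` for a tensor with four lower indices. -/
def cov4 (d : ι → Derivation ℝ R R) (Γ : ι → ι → ι → R) (T : ι → ι → ι → ι → R)
    (i a b c e : ι) : R :=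
  d i (T a b c e) - dot (Γ i a) (fun p => T p b c e) - dot (Γ i b) (fun p => T a p c e)
    - dot (Γ i c) (fun p => T a b p e) - dot (Γ i e) (fun p => T a b c p)

/-- `Γ` is the Levi-Civita connection of the metric `g` with inverse `h`, for the commuting
derivations `d`. -/
structure IsLeviCivita [DecidableEq ι] (d : ι → Derivation ℝ R R) (g h : ι → ι → R)
    (Γ : ι → ι → ι → R) : Prop where
  comm (i j : ι) (x : R) : d i (d j x) = d j (d i x)
  g_symm (a b : ι) : g a b = g b a
  h_symm (a b : ι) : h a b = h b a
  inv (a b : ι) : dot (h a) (g b) = if a = b then 1 else 0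
  Γ_symm (i j p : ι) : Γ i j p = Γ j i p
  compat (i a b : ι) : cov2 d Γ g i a b = 0

lemma derivation_dot (D : Derivation ℝ R R) (v X : ι → R) :
    D (dot v X) = dot (fun p => D (v p)) X + dot v (fun p => D (X p)) := by
  simp only [dot, map_sum, Derivation.leibniz, smul_eq_mul, Finset.sum_add_distrib]
  rw [add_comm]
  simp only [mul_comm]

variable [DecidableEq ι] {d : ι → Derivation ℝ R R} {g h : ι → ι → R} {Γ : ι → ι → ι → R}

namespace IsLeviCivita

lemma dot_inv (H : IsLeviCivita d g h Γ) (X : ι → R) (a : ι) :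
    dot (fun b => dot (h a) (g b)) X = X a := by
  change ∑ b, dot (h a) (g b) * X b = X a
  simp [H.inv]

lemma dot_inv' (H : IsLeviCivita d g h Γ) (X : ι → R) (a : ι) :
    dot (h a) (fun b => dot (g b) X) = X a := by
  rw [dot_dot, ← H.dot_inv X a]
  congr 1
  exact funext fun b => congrArg _ (funext fun c => H.g_symm c b)

lemma tr_g_left (H : IsLeviCivita d g h Γ) (X : ι → R) (l : ι) :
    tr h (fun p q => g p l * X q) = X l := by
  rw [← tr_transpose H.h_symm, tr]
  simp only [dot_mul_const]
  rw [← H.dot_inv X l]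
  have : ∀ p, dot (h p) (fun q => g q l) = dot (h l) (g p) := fun p => by
    have e1 : (fun q => g q l) = g l := funext fun q => H.g_symm q l
    rw [e1, H.inv, H.inv]
    simp only [eq_comm]
  simp only [this]
  rfl

lemma tr_g_right (H : IsLeviCivita d g h Γ) (X : ι → R) (l : ι) :
    tr h (fun p q => X p * g q l) = X l := by
  rw [← tr_transpose H.h_symm, ← H.tr_g_left X l]
  simp only [mul_comm]

lemma tr_g (H : IsLeviCivita d g h Γ) : tr h g = Fintype.card ι := by
  simp [tr, H.inv]

lemma tr_lower_left (H : IsLeviCivita d g h Γ) (u X : ι → R) :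
    tr h (fun p q => dot u (g p) * X q) = dot u X := by
  have e : ∀ p q, dot u (g p) * X q = dot u (fun a => g p a * X q) := fun p q => by simp
  simp only [e, tr_dot, H.tr_g_left]

lemma tr_lower_right (H : IsLeviCivita d g h Γ) (u X : ι → R) :
    tr h (fun p q => X p * dot u (g q)) = dot u X := by
  rw [← tr_transpose H.h_symm, ← H.tr_lower_left u X]
  exact congrArg _ (funext₂ fun p q => mul_comm _ _)

/-- A vector is determined by its lowered form. -/
lemma lower_injective (H : IsLeviCivita d g h Γ) {X Y : ι → R}
    (hXY : ∀ a, dot (g a) X = dot (g a) Y) (a : ι) : X a = Y a := by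
  rw [← H.dot_inv' X a, ← H.dot_inv' Y a]
  simp only [hXY]

lemma derivation_g (H : IsLeviCivita d g h Γ) (i a b : ι) :
    d i (g a b) = dot (Γ i a) (fun p => g p b) + dot (Γ i b) (fun p => g a p) := by
  have h1 := H.compat i a b
  unfold cov2 at h1
  linear_combination h1

/-- The inverse metric is parallel: differentiate `h g = δ`, insert ∇g = 0, and raise the remaining
index. -/
lemma derivation_h (H : IsLeviCivita d g h Γ) (i a b : ι) :
    d i (h a b) = -dot (h a) (fun c => Γ i c b) - dot (h b) (fun c => Γ i c a) := by
  have h1 : ∀ c, dot (g c) (fun p => d i (h a p) + dot (h a) (fun e => Γ i e p)) = -Γ i c a := by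
    intro c
    have h2 : dot (fun p => d i (h a p)) (g c) + dot (h a) (fun p => d i (g c p)) = 0 := by
      rw [← derivation_dot, H.inv]
      split_ifs <;> simp
    have h3 : dot (h a) (fun p => dot (Γ i c) fun e => g e p) = Γ i c a := by
      rw [dot_swap, dot_comm (Γ i c)]
      exact H.dot_inv (Γ i c) a
    simp only [H.derivation_g, dot_add, h3] at h2
    rw [dot_add, dot_comm (g c) (fun p => d i (h a p)), dot_comm (g c) (fun p => dot _ _), ← dot_dot]
    linear_combination h2
  have h4 : dot (h b) (fun c => dot (g c) (fun p => d i (h a p) + dot (h a) (fun e => Γ i e p)))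
      = d i (h a b) + dot (h a) (fun e => Γ i e b) := by
    rw [H.dot_inv']
  simp only [h1, dot_neg] at h4
  linear_combination -h4

/-- Traces commute with covariant derivatives. -/
lemma tr_cov2 (H : IsLeviCivita d g h Γ) (X : ι → ι → R) (i : ι) :
    tr h (cov2 d Γ X i) = d i (tr h X) := by
  have e1 : d i (tr h X) = tr (fun p q => d i (h p q)) X + tr h (fun p q => d i (X p q)) := by
    simp only [tr, map_sum, derivation_dot, Finset.sum_add_distrib]
  have e2 : tr (fun p q => d i (h p q)) X = - tr h (fun p q => dot (Γ i p) fun a => X a q)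
      - tr h (fun p q => dot (Γ i q) fun a => X p a) := by
    have e3 : tr h (fun p q => dot (Γ i p) fun a => X a q) =
        ∑ p, dot (fun q => dot (h q) (fun c => Γ i c p)) (X p) := by
      simp only [tr, dot_swap (h _)]
      have e6 : ∀ p, dot (fun q => dot (h q) (fun c => Γ i c p)) (X p) =
          ∑ c, Γ i c p * dot (h c) (X p) := fun p => by
        rw [← dot, dot_dot]
        congr 1
        funext q
        rw [dot_comm]
        exact congrArg _ (funext fun a => H.h_symm q a)
      rw [Finset.sum_congr rfl fun p _ => e6 p, Finset.sum_comm]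
      rfl
    have e4 : tr h (fun p q => dot (Γ i q) fun a => X p a) =
        ∑ p, dot (fun q => dot (h p) (fun c => Γ i c q)) (X p) := by
      simp only [tr, dot_dot]
    rw [e3, e4]
    rw [tr, ← Finset.sum_neg_distrib, ← Finset.sum_sub_distrib]
    refine Finset.sum_congr rfl fun p _ => ?_
    simp only [H.derivation_h, dot_comm _ (X p), dot_sub, dot_neg]
    ring
  have e5 : tr h (cov2 d Γ X i) = tr h (fun p q => d i (X p q))
      - tr h (fun p q => dot (Γ i p) fun a => X a q)
      - tr h (fun p q => dot (Γ i q) fun a => X p a) := by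
    rw [← tr_sub, ← tr_sub]
    rfl
  rw [e1, e2, e5]
  ring

end IsLeviCivita

/-- `∇ᵢ uᵃ` for a vector field. -/
def covU (d : ι → Derivation ℝ R R) (Γ : ι → ι → ι → R) (u : ι → R) (i a : ι) : R :=
  d i (u a) + dot u (fun p => Γ i p a)

omit [DecidableEq ι] in
-- The connection terms of the upper and the lower index cancel in a full contraction.
lemma derivation_dot_cov (d : ι → Derivation ℝ R R) (Γ : ι → ι → ι → R) (u X : ι → R) (i : ι) :
    d i (dot u X) = dot (covU d Γ u i) X + dot u (cov1 d Γ X i) := by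
  have e1 : dot (covU d Γ u i) X =
      dot (fun p => d i (u p)) X + dot (fun a => dot u (fun p => Γ i p a)) X := by
    rw [dot_comm, dot_comm _ X, dot_comm _ X, ← dot_add]
    rfl
  have e2 : dot u (cov1 d Γ X i) = dot u (fun p => d i (X p)) - dot u (fun a => dot (Γ i a) X) := by
    rw [← dot_sub]
    rfl
  rw [derivation_dot, e1, e2, ← dot_dot]
  ring

end Covariant

/-! ### Moving contractions with `h` and with `u` through covariant derivatives. -/

section Rank

variable {ι R : Type*} [Fintype ι] [CommRing R] [Algebra ℝ R] [DecidableEq ι]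
  {d : ι → Derivation ℝ R R} {g h : ι → ι → R} {Γ : ι → ι → ι → R}

lemma IsLeviCivita.tr_cov4 (H : IsLeviCivita d g h Γ) (T : ι → ι → ι → ι → R) (i k m : ι) :
    tr h (fun a b => cov4 d Γ T i a k b m) =
      cov2 d Γ (fun k m => tr h fun a b => T a k b m) i k m := by
  have h1 := H.tr_cov2 (fun a b => T a k b m) i
  have h2 : tr h (fun a b => cov4 d Γ T i a k b m) = tr h (cov2 d Γ (fun a b => T a k b m) i)
      - tr h (fun a b => dot (Γ i k) fun p => T a p b m)
      - tr h (fun a b => dot (Γ i m) fun p => T a k b p) := by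
    rw [← tr_sub, ← tr_sub]
    refine congrArg _ (funext₂ fun a b => ?_)
    unfold cov4 cov2
    ring
  rw [h2, h1, tr_dot, tr_dot]
  rfl

variable {u w : ι → R} {f : R}

lemma dot_covU (hu : ∀ i a, covU d Γ u i a = f * ((if i = a then 1 else 0) + w i * u a))
    (X : ι → R) (i : ι) : dot (covU d Γ u i) X = f * (X i + w i * dot u X) := by
  have h1 : covU d Γ u i = fun a => f * ((if i = a then 1 else 0) + w i * u a) := funext (hu i)
  rw [h1, dot_comm, dot_const_mul, dot_add, dot_const_mul, dot_comm u]
  simp [dot]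

/-- Product rule for the contraction with `u`; the subtracted term is ∇u contracted with `T`. -/
lemma dot_cov2 (hu : ∀ i a, covU d Γ u i a = f * ((if i = a then 1 else 0) + w i * u a))
    (T : ι → ι → R) (i a : ι) :
    dot u (cov2 d Γ T i a) =
      cov1 d Γ (fun a => dot u (T a)) i a - f * (T a i + w i * dot u (T a)) := by
  have h1 := derivation_dot_cov d Γ u (T a) i
  rw [dot_covU hu] at h1
  have h2 : dot u (cov2 d Γ T i a) =
      dot u (cov1 d Γ (T a) i) - dot u (fun b => dot (Γ i a) fun p => T p b) := by
    rw [← dot_sub]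
    refine congrArg _ (funext fun b => ?_)
    unfold cov2 cov1
    ring
  rw [dot_swap] at h2
  unfold cov1 at h2 h1 ⊢
  linear_combination h2 - h1

lemma dot_cov4 (hu : ∀ i a, covU d Γ u i a = f * ((if i = a then 1 else 0) + w i * u a))
    (T : ι → ι → ι → ι → R) (i a b c : ι) :
    dot u (cov4 d Γ T i a b c) =
      cov3 d Γ (fun a b c => dot u (T a b c)) i a b c
        - f * (T a b c i + w i * dot u (T a b c)) := by
  have h1 := derivation_dot_cov d Γ u (T a b c) i
  rw [dot_covU hu] at h1
  have h2 : dot u (cov4 d Γ T i a b c) =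
      dot u (cov1 d Γ (T a b c) i) - dot u (fun e => dot (Γ i a) fun p => T p b c e)
      - dot u (fun e => dot (Γ i b) fun p => T a p c e)
      - dot u (fun e => dot (Γ i c) fun p => T a b p e) := by
    simp only [← dot_sub]
    refine congrArg _ (funext fun e => ?_)
    unfold cov4 cov1
    ring
  rw [dot_swap u (Γ i a), dot_swap u (Γ i b), dot_swap u (Γ i c)] at h2
  unfold cov3
  unfold cov1 at h2 h1
  linear_combination h2 - h1

end Rank

/-! ### Symmetries of the curvature and the Bianchi identities. -/

section Curvature

variable {ι R : Type*} [Fintype ι] [CommRing R] [Algebra ℝ R]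

/-- The curvature `Rᵢⱼₖᵐ` (last index upper) of the connection `Γ`. -/
def curvUp (d : ι → Derivation ℝ R R) (Γ : ι → ι → ι → R) (i j k m : ι) : R :=
  d j (Γ i k m) - d i (Γ j k m)
    + (dot (Γ i k) (fun p => Γ j p m) - dot (Γ j k) (fun p => Γ i p m))

/-- The curvature `Rᵢⱼₖₘ`. -/
def curv (d : ι → Derivation ℝ R R) (g : ι → ι → R) (Γ : ι → ι → ι → R) (i j k m : ι) : R :=
  dot (curvUp d Γ i j k) (fun p => g p m)

/-- The Ricci identity. -/
lemma cov2_cov1_sub {d : ι → Derivation ℝ R R} {Γ : ι → ι → ι → R}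
    (hd : ∀ i j x, d i (d j x) = d j (d i x)) (hΓ : ∀ i j p, Γ i j p = Γ j i p)
    (w : ι → R) (i j k : ι) :
    cov2 d Γ (cov1 d Γ w) i j k - cov2 d Γ (cov1 d Γ w) j i k = dot (curvUp d Γ i j k) w := by
  have e : dot (curvUp d Γ i j k) w = dot (fun m => d j (Γ i k m)) w - dot (fun m => d i (Γ j k m)) w
      + (dot (Γ i k) (fun p => dot (Γ j p) w) - dot (Γ j k) (fun p => dot (Γ i p) w)) := by
    rw [dot_dot, dot_dot]
    simp only [dot_comm _ w]
    rw [← dot_sub, ← dot_sub, ← dot_add]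
    rfl
  have hij : Γ i j = Γ j i := funext (hΓ i j)
  rw [e]
  unfold cov2 cov1
  simp only [map_sub, derivation_dot, dot_sub, hd i j, hij]
  ring

section Matrix

variable (d : ι → Derivation ℝ R R) (g : Matrix ι ι R) (Γ : ι → Matrix ι ι R)

lemma derivation_matrix_mul (D : Derivation ℝ R R) (M N : Matrix ι ι R) :
    (M * N).map D = M.map D * N + M * N.map D := by
  ext a b
  exact derivation_dot D (M a) fun p => N p b

omit [Fintype ι] in
lemma derivation_matrix_add (D : Derivation ℝ R R) (M N : Matrix ι ι R) :
    (M + N).map D = M.map D + N.map D := by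
  ext a b
  simp

omit [Fintype ι] in
lemma derivation_matrix_sub (D : Derivation ℝ R R) (M N : Matrix ι ι R) :
    (M - N).map D = M.map D - N.map D := by
  ext a b
  simp

/-- The curvature as a family of matrices. -/
def curvMatrix (i j : ι) : Matrix ι ι R :=
  (Γ i).map (d j) - (Γ j).map (d i) + (Γ i * Γ j - Γ j * Γ i)

omit [Fintype ι] in
variable {d} in
lemma derivation_matrix_comm (hd : ∀ i j x, d i (d j x) = d j (d i x)) (i j : ι)
    (M : Matrix ι ι R) : (M.map (d j)).map (d i) = (M.map (d i)).map (d j) := by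
  ext a b
  exact hd i j _

variable {d g Γ}

/-- `curvMatrix d Γ i j` is the commutator of the operators ∂ᵢ - Γᵢ and ∂ⱼ - Γⱼ, so this is the
Jacobi identity. -/
lemma curvMatrix_bianchi (hd : ∀ i j x, d i (d j x) = d j (d i x)) (i j k : ι) :
    ((curvMatrix d Γ j k).map (d i) - Γ i * curvMatrix d Γ j k + curvMatrix d Γ j k * Γ i)
    + ((curvMatrix d Γ k i).map (d j) - Γ j * curvMatrix d Γ k i + curvMatrix d Γ k i * Γ j)
    + ((curvMatrix d Γ i j).map (d k) - Γ k * curvMatrix d Γ i j + curvMatrix d Γ i j * Γ k)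
      = 0 := by
  unfold curvMatrix
  simp only [derivation_matrix_add, derivation_matrix_sub, derivation_matrix_mul]
  rw [derivation_matrix_comm hd i j, derivation_matrix_comm hd i k, derivation_matrix_comm hd j k]
  noncomm_ring

/-- Second derivatives of `g` commute; expanding both orders by compatibility leaves exactly the
action of the curvature on `g`. -/
lemma curvMatrix_skew (hd : ∀ i j x, d i (d j x) = d j (d i x))
    (hg : ∀ i, g.map (d i) = Γ i * g + g * (Γ i).transpose) (i j : ι) :
    curvMatrix d Γ i j * g + g * (curvMatrix d Γ i j).transpose = 0 := by
  have h1 := derivation_matrix_comm hd i j g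
  have e : ∀ i j, ((Γ i).transpose).map (d j) = ((Γ i).map (d j)).transpose := fun i j => rfl
  rw [hg, hg] at h1
  simp only [derivation_matrix_add, derivation_matrix_mul, hg, e] at h1
  unfold curvMatrix
  simp only [Matrix.transpose_add, Matrix.transpose_sub, Matrix.transpose_mul]
  rw [← sub_eq_zero] at h1
  rw [← neg_eq_zero, ← h1]
  noncomm_ring

end Matrix

variable [DecidableEq ι] {d : ι → Derivation ℝ R R} {g h : ι → ι → R} {Γ : ι → ι → ι → R}

omit [DecidableEq ι] in
lemma curv_swap_left (i j k m : ι) : curv d g Γ i j k m = -curv d g Γ j i k m := by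
  unfold curv
  rw [dot_comm, dot_comm (curvUp d Γ j i k), ← dot_neg]
  refine congrArg _ (funext fun p => ?_)
  unfold curvUp
  ring

namespace IsLeviCivita

lemma map_g (H : IsLeviCivita d g h Γ) (i : ι) :
    (Matrix.of g).map (d i) = Matrix.of (Γ i) * Matrix.of g
      + Matrix.of g * (Matrix.of (Γ i)).transpose := by
  ext a b
  rw [Matrix.add_apply]
  refine (H.derivation_g i a b).trans (congrArg _ (dot_comm _ _))

lemma curv_swap_right (H : IsLeviCivita d g h Γ) (i j k m : ι) :
    curv d g Γ i j k m = -curv d g Γ i j m k := by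
  have h1 := congrFun₂ (curvMatrix_skew H.comm H.map_g i j) k m
  rw [Matrix.add_apply] at h1
  have h2 : (Matrix.of g * (curvMatrix d (fun i => Matrix.of (Γ i)) i j).transpose) k m
      = curv d g Γ i j m k := by
    unfold curv
    rw [dot_comm]
    exact congrArg₂ dot (funext fun p => H.g_symm k p) rfl
  rw [h2] at h1
  exact eq_neg_of_add_eq_zero_left h1

lemma curv_cyclic (H : IsLeviCivita d g h Γ) (i j k m : ι) :
    curv d g Γ i j k m + curv d g Γ j k i m + curv d g Γ k i j m = 0 := by
  unfold curv
  simp only [dot_comm _ fun p => g p m]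
  rw [← dot_add, ← dot_add]
  refine Eq.trans (congrArg _ (funext fun p => ?_)) (dot_zero _)
  have h1 : Γ i j = Γ j i := funext (H.Γ_symm i j)
  have h2 : Γ i k = Γ k i := funext (H.Γ_symm i k)
  have h3 : Γ j k = Γ k j := funext (H.Γ_symm j k)
  unfold curvUp
  rw [h1, h2, h3]
  ring

/-- The classical argument: a signed sum of four cyclic identities, simplified by antisymmetry in
each pair, gives twice the difference. -/
lemma curv_pair (H : IsLeviCivita d g h Γ) (i j k m : ι) :
    curv d g Γ i j k m = curv d g Γ k m i j := by
  have s := fun i j k m => curv_swap_left (d := d) (g := g) (Γ := Γ) i j k m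
  have t := H.curv_swap_right
  have c := H.curv_cyclic
  refine sub_eq_zero.mp (intCast_mul_cancel (k := 2) (by norm_num) ?_)
  push_cast
  linear_combination c i j k m + c j k m i - c k m i j - c m i j k - t j k m i - t k m j i
    + s i k m j - t k i m j + t m i j k + t i j m k + s j m i k - t m j i k

lemma bianchi (H : IsLeviCivita d g h Γ) (i j k l m : ι) :
    cov4 d Γ (curv d g Γ) i j k l m + cov4 d Γ (curv d g Γ) j k i l m
      + cov4 d Γ (curv d g Γ) k i j l m = 0 := by
  -- The connection terms of the slots `l` and `m` form the commutator of the matrix identity, the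
  -- derivative of `g` absorbing that of `m`. Those of the first two slots cancel in the cyclic sum,
  -- since `Γ` is symmetric and the curvature antisymmetric.
  have e : ∀ i j k, cov4 d Γ (curv d g Γ) i j k l m =
      (((curvMatrix d (fun i => Matrix.of (Γ i)) j k).map (d i)
        - Matrix.of (Γ i) * curvMatrix d (fun i => Matrix.of (Γ i)) j k
        + curvMatrix d (fun i => Matrix.of (Γ i)) j k * Matrix.of (Γ i)) * Matrix.of g) l m
      - dot (Γ i j) (fun p => curv d g Γ p k l m) - dot (Γ i k) (fun p => curv d g Γ j p l m) := by
    intro i j k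
    set F := curvMatrix d (fun i => Matrix.of (Γ i)) j k with hF
    have h1 : d i (curv d g Γ j k l m) = (F.map (d i) * Matrix.of g) l m
        + (F * (Matrix.of (Γ i) * Matrix.of g + Matrix.of g * (Matrix.of (Γ i)).transpose)) l m := by
      rw [← H.map_g, ← Matrix.add_apply, ← derivation_matrix_mul]
      rfl
    have h2 : dot (Γ i l) (fun p => curv d g Γ j k p m) =
      (Matrix.of (Γ i) * (F * Matrix.of g)) l m := rfl
    have h3 : dot (Γ i m) (fun p => curv d g Γ j k l p) =
        ((F * Matrix.of g) * (Matrix.of (Γ i)).transpose) l m := dot_comm _ _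
    unfold cov4
    rw [h1, h2, h3]
    simp only [Matrix.add_mul, Matrix.sub_mul, Matrix.mul_add, Matrix.add_apply, Matrix.sub_apply,
      Matrix.mul_assoc]
    ring
  have hB := congrArg (fun M => (M * Matrix.of g) l m)
    (curvMatrix_bianchi (d := d) (Γ := fun i => Matrix.of (Γ i)) H.comm i j k)
  simp only [Matrix.add_mul, Matrix.add_apply, Matrix.zero_mul, Matrix.zero_apply] at hB
  have h1 : Γ i j = Γ j i := funext (H.Γ_symm i j)
  have h2 : Γ i k = Γ k i := funext (H.Γ_symm i k)
  have h3 : Γ j k = Γ k j := funext (H.Γ_symm j k)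
  have s : ∀ v : ι → R, ∀ a, dot v (fun p => curv d g Γ p a l m)
      = -dot v (fun p => curv d g Γ a p l m) := fun v a => by
    rw [← dot_neg]
    exact congrArg _ (funext fun p => curv_swap_left p a l m)
  rw [e, e, e, s, s, s, h1, h2, h3]
  simp only [Matrix.add_mul, Matrix.add_apply]
  linear_combination hB

end IsLeviCivita

end Curvature

/-! ### The Weyl tensor: symmetries and second Bianchi identity. -/

section WeylTensor

variable {ι R : Type*} [Fintype ι] [CommRing R]

/-- The combination `Aᵢₘ Bₖₗ - Aₖₘ Bᵢₗ - Aᵢₗ Bₖₘ + Aₖₗ Bᵢₘ` (indices in the order `i k l m`). -/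
def kn (A B : ι → ι → R) (i k l m : ι) : R :=
  A i m * B k l - A k m * B i l - A i l * B k m + A k l * B i m

/-- The algebraic symmetries of the Weyl tensor. -/
structure IsWeylTensor (h : ι → ι → R) (C : ι → ι → ι → ι → R) : Prop where
  swap_left (i j k m : ι) : C i j k m = -C j i k m
  swap_right (i j k m : ι) : C i j k m = -C i j m k
  pair (i j k m : ι) : C i j k m = C k m i j
  cyclic (i j k m : ι) : C i j k m + C j k i m + C k i j m = 0
  trace (k m : ι) : tr h (fun j l => C j k l m) = 0

variable [Algebra ℝ R] {d : ι → Derivation ℝ R R} {Γ : ι → ι → ι → R}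

lemma cov4_add (S T : ι → ι → ι → ι → R) (i a b c e : ι) :
    cov4 d Γ (fun a b c e => S a b c e + T a b c e) i a b c e =
      cov4 d Γ S i a b c e + cov4 d Γ T i a b c e := by
  unfold cov4
  simp only [map_add, dot_add]
  ring

lemma cov4_kn (A B : ι → ι → R) (i a b c e : ι) :
    cov4 d Γ (kn A B) i a b c e =
      kn (cov2 d Γ A i) B a b c e + kn A (cov2 d Γ B i) a b c e := by
  unfold cov4 kn cov2
  simp only [map_add, map_sub, Derivation.leibniz, smul_eq_mul, dot_add, dot_sub, dot_mul_const,
    dot_const_mul]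
  ring

variable {h : ι → ι → R} {C : ι → ι → ι → ι → R} [DecidableEq ι] {g : ι → ι → R}

/-- The symmetries are linear relations between permuted slots, which ∇ respects, and ∇ commutes
with the metric trace. -/
lemma IsWeylTensor.cov (hC : IsWeylTensor h C) (H : IsLeviCivita d g h Γ) (i : ι) :
    IsWeylTensor h (cov4 d Γ C i) where
  swap_left a b c e := by
    unfold cov4
    rw [hC.swap_left a b c e]
    simp only [map_neg]
    have e1 : (fun p => C p b c e) = fun p => -C b p c e := funext fun p => hC.swap_left _ _ _ _
    have e2 : (fun p => C a p c e) = fun p => -C p a c e := funext fun p => hC.swap_left _ _ _ _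
    have e3 : (fun p => C a b p e) = fun p => -C b a p e := funext fun p => hC.swap_left _ _ _ _
    have e4 : (fun p => C a b c p) = fun p => -C b a c p := funext fun p => hC.swap_left _ _ _ _
    rw [e1, e2, e3, e4]
    simp only [dot_neg]
    ring
  swap_right a b c e := by
    unfold cov4
    rw [hC.swap_right a b c e]
    simp only [map_neg]
    have e1 : (fun p => C p b c e) = fun p => -C p b e c := funext fun p => hC.swap_right _ _ _ _
    have e2 : (fun p => C a p c e) = fun p => -C a p e c := funext fun p => hC.swap_right _ _ _ _
    have e3 : (fun p => C a b p e) = fun p => -C a b e p := funext fun p => hC.swap_right _ _ _ _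
    have e4 : (fun p => C a b c p) = fun p => -C a b p c := funext fun p => hC.swap_right _ _ _ _
    rw [e1, e2, e3, e4]
    simp only [dot_neg]
    ring
  pair a b c e := by
    unfold cov4
    rw [hC.pair a b c e]
    have e1 : (fun p => C p b c e) = fun p => C c e p b := funext fun p => hC.pair _ _ _ _
    have e2 : (fun p => C a p c e) = fun p => C c e a p := funext fun p => hC.pair _ _ _ _
    have e3 : (fun p => C a b p e) = fun p => C p e a b := funext fun p => hC.pair _ _ _ _
    have e4 : (fun p => C a b c p) = fun p => C c p a b := funext fun p => hC.pair _ _ _ _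
    rw [e1, e2, e3, e4]
    ring
  cyclic a b c e := by
    have e1 := congrArg (d i) (hC.cyclic a b c e)
    have e2 : ∀ b c e, (fun p => C p b c e) = fun p => -C b c p e - C c p b e := fun b c e =>
      funext fun p => by linear_combination hC.cyclic p b c e
    have e3 : (fun p => C a b c p) = fun p => -C b c a p - C c a b p :=
      funext fun p => by linear_combination hC.cyclic a b c p
    unfold cov4
    rw [e2 b c e, e2 c a e, e2 a b e, e3]
    simp only [map_add, map_zero, dot_sub, dot_neg] at e1 ⊢
    linear_combination e1
  trace k m := by
    rw [H.tr_cov4]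
    simp [hC.trace, cov2]

/-- A unit vector field `u` with lowered form `w` and `∇ᵢ wⱼ = f (gᵢⱼ + wᵢ wⱼ)`. -/
structure IsTorseForming (d : ι → Derivation ℝ R R) (g : ι → ι → R) (Γ : ι → ι → ι → R)
    (u w : ι → R) (f : R) : Prop where
  lower (a : ι) : dot u (g a) = w a
  unit : dot u w = -1
  cov (i j : ι) : cov1 d Γ w i j = f * (g i j + w i * w j)

variable {u w : ι → R} {f : R}

/-- Since `g` is parallel, the index of ∇w can be raised; the comparison is made between the lowered
forms. -/
lemma IsTorseForming.covU (hu : IsTorseForming d g Γ u w f) (H : IsLeviCivita d g h Γ) (i a : ι) :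
    covU d Γ u i a = f * ((if i = a then 1 else 0) + w i * u a) := by
  refine H.lower_injective (X := IndexCalculus.covU d Γ u i)
    (Y := fun a => f * ((if i = a then 1 else 0) + w i * u a)) (fun b => ?_) a
  have h1 := derivation_dot_cov d Γ u (g b) i
  have h2 : cov1 d Γ (g b) i = fun c => dot (Γ i b) fun p => g p c := funext fun c => by
    unfold cov1
    rw [H.derivation_g]
    ring
  rw [h2, dot_swap] at h1
  simp only [hu.lower] at h1
  have h3 := hu.cov i b
  unfold cov1 at h3
  rw [dot_const_mul, dot_add, dot_const_mul, dot_comm _ u, hu.lower, dot_comm]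
  have h4 : dot (g b) (fun p => if i = p then 1 else 0) = g i b := by
    simp [dot, H.g_symm]
  rw [h4]
  linear_combination h3 - h1

section Weyl

variable {P : ι → ι → R}

lemma isWeylTensor_add_kn (H : IsLeviCivita d g h Γ) (hP : ∀ a b, P a b = P b a)
    (hC : ∀ i j k m, C i j k m = curv d g Γ i j k m + kn g P i j k m)
    (htr : ∀ k m, tr h (fun j l => C j k l m) = 0) : IsWeylTensor h C where
  swap_left i j k m := by
    rw [hC, hC, curv_swap_left]
    unfold kn
    ring
  swap_right i j k m := by
    rw [hC, hC, H.curv_swap_right]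
    unfold kn
    ring
  pair i j k m := by
    rw [hC, hC, H.curv_pair]
    unfold kn
    rw [H.g_symm i m, H.g_symm j m, H.g_symm i k, H.g_symm j k, hP i m, hP j m, hP i k, hP j k]
    ring
  cyclic i j k m := by
    rw [hC, hC, hC]
    unfold kn
    rw [H.g_symm j k, H.g_symm k i, H.g_symm j i, hP j k, hP k i, hP j i]
    linear_combination H.curv_cyclic i j k m
  trace := htr

/-- The second Bianchi identity of the Weyl tensor. -/
lemma weyl_bianchi (H : IsLeviCivita d g h Γ)
    (hC : ∀ i j k m, C i j k m = curv d g Γ i j k m + kn g P i j k m) (i j k l m : ι) :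
    cov4 d Γ C i j k l m + cov4 d Γ C j k i l m + cov4 d Γ C k i j l m =
      -(g j l * (cov2 d Γ P i k m - cov2 d Γ P k i m) - g j m * (cov2 d Γ P i k l - cov2 d Γ P k i l)
      + g k l * (cov2 d Γ P j i m - cov2 d Γ P i j m) - g k m * (cov2 d Γ P j i l - cov2 d Γ P i j l)
      + g i l * (cov2 d Γ P k j m - cov2 d Γ P j k m)
      - g i m * (cov2 d Γ P k j l - cov2 d Γ P j k l)) := by
  have e : C = fun i j k m => curv d g Γ i j k m + kn g P i j k m :=
    funext₂ fun i j => funext₂ fun k m => hC i j k m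
  have hg : ∀ i, cov2 d Γ g i = fun _ _ => 0 := fun i => funext₂ fun a b => H.compat i a b
  have e2 : ∀ i j k l m, cov4 d Γ C i j k l m =
      cov4 d Γ (curv d g Γ) i j k l m + kn g (cov2 d Γ P i) j k l m := fun i j k l m => by
    rw [e, cov4_add, cov4_kn, hg]
    simp [kn]
  rw [e2, e2, e2]
  unfold kn
  linear_combination H.bianchi i j k l m

/-- The divergence of the Weyl tensor determines the right side of its second Bianchi identity. -/
lemma weyl_bianchi_div (H : IsLeviCivita d g h Γ) (hn : 2 < Fintype.card ι)
    (hP : ∀ a b, P a b = P b a)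
    (hC : ∀ i j k m, C i j k m = curv d g Γ i j k m + kn g P i j k m)
    (htr : ∀ k m, tr h (fun j l => C j k l m) = 0) {D : ι → ι → ι → R}
    (hD : ∀ j k l, D j k l = tr h fun p q => cov4 d Γ C p j k l q) (i j k l m : ι) :
    ((Fintype.card ι : R) - 3) *
      (cov4 d Γ C i j k l m + cov4 d Γ C j k i l m + cov4 d Γ C k i j l m) =
      g j l * D i k m - g j m * D i k l + g k l * D j i m - g k m * D j i l
      + g i l * D k j m - g i m * D k j l := by
  have hW := isWeylTensor_add_kn H hP hC htr
  have hB := weyl_bianchi H hC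
  -- The Cotton tensor of `P`; from here on only its antisymmetry and the relation `hB` matter.
  set A : ι → ι → ι → R := fun i k m => cov2 d Γ P i k m - cov2 d Γ P k i m with hA
  have hA' : ∀ i k m, A i k m = -A k i m := fun i k m => by
    simp only [hA]
    ring
  replace hB : ∀ i j k l m, cov4 d Γ C i j k l m + cov4 d Γ C j k i l m + cov4 d Γ C k i j l m =
      -(g j l * A i k m - g j m * A i k l + g k l * A j i m - g k m * A j i l
      + g i l * A k j m - g i m * A k j l) := hB
  clear_value A
  -- Trace `hB` over `i` and `m`: two of the three terms on the left vanish because ∇C is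
  -- trace-free.
  have h1 : ∀ j k l, D j k l = -(g j l * tr h (fun i m => A i k m)
      - g k l * tr h (fun i m => A i j m) + ((Fintype.card ι : R) - 3) * A j k l) := by
    intro j k l
    have h2 := congrArg (tr h) (funext₂ fun i m => hB i j k l m)
    have e1 : tr h (fun i m => cov4 d Γ C j k i l m) = 0 := by
      rw [← (hW.cov H j).trace k l]
      refine congrArg _ (funext₂ fun i m => ?_)
      rw [(hW.cov H j).swap_left, (hW.cov H j).swap_right, neg_neg]
    have e2 : tr h (fun i m => cov4 d Γ C k i j l m) = 0 := by
      rw [← neg_zero, ← (hW.cov H k).trace j l, ← tr_neg]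
      exact congrArg _ (funext₂ fun i m => (hW.cov H k).swap_right _ _ _ _)
    have e3 : tr h (fun i m => g j m * A i k l) = A j k l := by
      rw [← H.tr_g_right (fun i => A i k l) j]
      exact congrArg _ (funext₂ fun i m => by rw [H.g_symm]; ring)
    have e4 : tr h (fun i m => g k m * A j i l) = A j k l := by
      rw [← H.tr_g_right (fun i => A j i l) k]
      exact congrArg _ (funext₂ fun i m => by rw [H.g_symm]; ring)
    have e5 : tr h (fun i m => A j i m) = - tr h (fun i m => A i j m) := by
      rw [← tr_neg]
      exact congrArg _ (funext₂ fun i m => hA' _ _ _)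
    have e6 : tr h (fun i m => g i l * A k j m) = A k j l := H.tr_g_left (fun m => A k j m) l
    simp only [tr_add, tr_sub, tr_neg, tr_mul_const, tr_const_mul] at h2
    rw [← hD, e1, e2] at h2
    have e7 : tr h (fun p q => g p q) = Fintype.card ι := H.tr_g
    linear_combination h2 + e3 + e4 - e6 - g k l * e5 + A k j l * e7
      + ((Fintype.card ι : R) - 1) * hA' k j l
  -- `D` is trace-free, so a further trace of `h1` gives (4 - 2n) tr A = 0. This takes the place of
  -- the contracted Bianchi identity of the Ricci tensor.
  have h0 : ∀ j, tr h (fun i m => A i j m) = 0 := by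
    intro j
    refine intCast_mul_cancel (k := 4 - 2 * Fintype.card ι) (by omega) ?_
    have h3 : tr h (fun k l => D j k l) = 0 := by
      simp only [hD]
      rw [tr_tr]
      refine Eq.trans (congrArg _ (funext₂ fun a b => ?_)) (tr_zero h)
      rw [← neg_zero, ← (hW.cov H a).trace j b, ← tr_neg]
      exact congrArg _ (funext₂ fun k l => (hW.cov H a).swap_left _ _ _ _)
    simp only [h1] at h3
    have e1 : tr h (fun k l => g j l * tr h fun i m => A i k m) = tr h (fun i m => A i j m) := by
      rw [← H.tr_g_right (fun k => tr h fun i m => A i k m) j]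
      exact congrArg _ (funext₂ fun i m => by rw [H.g_symm]; ring)
    have e5 : tr h (fun i m => A j i m) = - tr h (fun i m => A i j m) := by
      rw [← tr_neg]
      exact congrArg _ (funext₂ fun i m => hA' _ _ _)
    have e7 : tr h (fun p q => g p q) = Fintype.card ι := H.tr_g
    simp only [tr_neg, tr_add, tr_sub, tr_mul_const, tr_const_mul, e1, e5, e7] at h3
    push_cast
    linear_combination -h3
  simp only [h0] at h1
  rw [hB]
  simp only [h1]
  ring

end Weyl

end WeylTensor

/-! ### The Weyl tensor of a twisted space-time and its electric part. -/

section Electric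

variable {ι R : Type*} [Fintype ι] [CommRing R] [Algebra ℝ R] [DecidableEq ι]
  {d : ι → Derivation ℝ R R} {g h : ι → ι → R} {Γ : ι → ι → ι → R}
  {u w : ι → R} {f : R} {C : ι → ι → ι → ι → R} {P : ι → ι → R} {E : ι → ι → R}

omit [DecidableEq ι] in
lemma dot_dot_antisymm (u : ι → R) {T : ι → ι → R} (hT : ∀ a b, T a b = -T b a) :
    dot u (fun a => dot u (T a)) = 0 := by
  refine intCast_mul_cancel (k := 2) (by norm_num) ?_
  have h1 : dot u (fun a => dot u (T a)) = -dot u (fun a => dot u (T a)) := by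
    conv_lhs => rw [dot_swap]
    simp only [← dot_neg]
    exact congrArg _ (funext fun b => congrArg _ (funext fun a => hT a b))
  push_cast
  linear_combination h1

/-- Ricci identity for `w`, with ∇w inserted twice; the terms in `f * f` come from differentiating
`w` inside ∇w. -/
lemma IsTorseForming.dot_curv (H : IsLeviCivita d g h Γ) (T : IsTorseForming d g Γ u w f)
    (j k l : ι) :
    dot u (curv d g Γ j k l) =
      (g k l + w k * w l) * (d j f - f * f * w j) - (g j l + w j * w l) * (d k f - f * f * w k) := by
  have e1 : dot u (curv d g Γ j k l) = dot (curvUp d Γ j k l) w := by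
    unfold curv
    rw [dot_swap]
    exact congrArg _ (funext fun p => T.lower p)
  have e2 : cov1 d Γ w = fun i j => f * (g i j + w i * w j) :=
    funext₂ fun i j => T.cov i j
  have e3 : ∀ i a, d i (w a) = f * (g i a + w i * w a) + dot (Γ i a) w := fun i a => by
    rw [← T.cov]
    unfold cov1
    ring
  rw [e1, ← cov2_cov1_sub H.comm H.Γ_symm, e2]
  unfold cov2
  simp only [Derivation.leibniz, map_add, smul_eq_mul, H.derivation_g, e3, dot_const_mul, dot_add,
    dot_mul_const]
  have h1 : Γ j k = Γ k j := funext (H.Γ_symm j k)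
  rw [h1, H.g_symm k j]
  ring

/-- The magnetic part of the Weyl tensor vanishes. -/
lemma IsTorseForming.dot_weyl (H : IsLeviCivita d g h Γ) (T : IsTorseForming d g Γ u w f)
    (hn : 2 < Fintype.card ι)
    (hC : ∀ i j k m, C i j k m = curv d g Γ i j k m + kn g P i j k m)
    (htr : ∀ k m, tr h (fun j l => C j k l m) = 0)
    (hE : ∀ k l, E k l = dot u fun j => dot u (C j k l)) (j k l : ι) :
    dot u (C j k l) = w k * E j l - w j * E k l := by
  set a : ι → R := fun j => d j f - f * f * w j with ha
  set q : ι → R := fun k => dot u (P k) with hq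
  have h1 : ∀ j k l, dot u (C j k l) =
      (g k l + w k * w l) * a j - (g j l + w j * w l) * a k
      + (w j * P k l - w k * P j l - g j l * q k + g k l * q j) := by
    intro j k l
    have e : dot u (C j k l) = dot u (curv d g Γ j k l) + dot u (kn g P j k l) := by
      rw [← dot_add]
      exact congrArg _ (funext fun m => hC j k l m)
    rw [e, T.dot_curv H, ← T.lower j, ← T.lower k]
    unfold kn
    simp only [dot_add, dot_sub, dot_mul_const, dot_const_mul]
    simp only [T.lower]
    rfl
  -- The trace of `h1` over `j` and `l` vanishes, which forces `a + q`, up to the factor n - 2, to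
  -- be a multiple of `w`.
  have h2 : ∀ k, ((Fintype.card ι : R) - 2) * (a k + q k) = w k * (dot u a - tr h P) := by
    intro k
    have e0 : tr h (fun j l => dot u (C j k l)) = 0 := by
      rw [tr_dot]
      simp only [htr, dot_zero]
    have e1 : ∀ X : ι → R, tr h (fun j l => g k l * X j) = X k := fun X => by
      rw [← H.tr_g_right X k]
      exact congrArg _ (funext₂ fun i m => by rw [H.g_symm]; ring)
    have e2 : ∀ X : ι → R, tr h (fun j l => w l * X j) = dot u X := fun X => by
      rw [← H.tr_lower_right u X]
      exact congrArg _ (funext₂ fun i m => by rw [T.lower]; ring)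
    have e3 : ∀ X : ι → R, tr h (fun j l => w j * X l) = dot u X := fun X => by
      rw [← H.tr_lower_left u X]
      exact congrArg _ (funext₂ fun i m => by rw [T.lower])
    have e4 : tr h (fun j l => dot u (C j k l)) = tr h (fun j l => g k l * a j)
      + w k * tr h (fun j l => w l * a j) - tr h g * a k - tr h (fun j l => w j * w l) * a k
      + tr h (fun j l => w j * P k l) - w k * tr h P - tr h g * q k
      + tr h (fun j l => g k l * q j) := by
      simp only [← tr_add, ← tr_sub, ← tr_mul_const, ← tr_const_mul]
      refine congrArg _ (funext₂ fun j l => ?_)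
      rw [h1]
      ring
    rw [e0, e1, e1, e2, e3, e3, H.tr_g, T.unit] at e4
    linear_combination e4
  -- Substituting `h2` into `h1` leaves an antisymmetrized product of `w` and `Y`. One more
  -- contraction with `u` shows that (n - 2)E is -Y up to a term wₖ(…), which antisymmetrization
  -- removes.
  set Y : ι → ι → R := fun k l => (dot u a - tr h P) * g k l
    + ((Fintype.card ι : R) - 2) * (P k l - w l * a k) with hY
  have h3 : ∀ j k l, ((Fintype.card ι : R) - 2) * dot u (C j k l) = w j * Y k l - w k * Y j l := by
    intro j k l
    rw [h1]
    linear_combination g k l * h2 j - g j l * h2 k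
  have h4 : ∀ k l, ((Fintype.card ι : R) - 2) * E k l = -Y k l - w k * dot u fun j => Y j l := by
    intro k l
    rw [hE, ← dot_const_mul]
    simp only [h3, dot_sub, dot_mul_const, dot_const_mul]
    rw [T.unit]
    ring
  refine sub_eq_zero.mp (intCast_mul_cancel (k := Fintype.card ι - 2) (by omega) ?_)
  push_cast
  linear_combination h3 j k l - w k * h4 j l + w j * h4 k l

/-- The Weyl tensor of a twisted space-time, with its electric part. -/
structure IsTwistedWeyl (d : ι → Derivation ℝ R R) (g h : ι → ι → R) (Γ : ι → ι → ι → R)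
    (u w : ι → R) (f : R) (C : ι → ι → ι → ι → R) (E : ι → ι → R) : Prop where
  connection : IsLeviCivita d g h Γ
  torse : IsTorseForming d g Γ u w f
  weyl : IsWeylTensor h C
  electric (k l : ι) : E k l = dot u fun j => dot u (C j k l)
  magnetic (j k l : ι) : dot u (C j k l) = w k * E j l - w j * E k l
  bianchi (i j k l m : ι) :
    ((Fintype.card ι : R) - 3) *
      (cov4 d Γ C i j k l m + cov4 d Γ C j k i l m + cov4 d Γ C k i j l m) =
      g j l * tr h (fun p q => cov4 d Γ C p i k m q) - g j m * tr h (fun p q => cov4 d Γ C p i k l q)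
      + g k l * tr h (fun p q => cov4 d Γ C p j i m q)
      - g k m * tr h (fun p q => cov4 d Γ C p j i l q)
      + g i l * tr h (fun p q => cov4 d Γ C p k j m q)
      - g i m * tr h (fun p q => cov4 d Γ C p k j l q)

namespace IsTwistedWeyl

lemma electric_symm (S : IsTwistedWeyl d g h Γ u w f C E) (k l : ι) : E k l = E l k := by
  rw [S.electric, S.electric, dot_swap]
  refine congrArg _ (funext fun a => congrArg _ (funext fun b => ?_))
  rw [S.weyl.pair, S.weyl.swap_left, S.weyl.swap_right, neg_neg]

lemma dot_electric (S : IsTwistedWeyl d g h Γ u w f C E) (k : ι) : dot u (E k) = 0 := by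
  have e : E k = fun l => dot u fun j => dot u (C j k l) := funext fun l => S.electric k l
  rw [e, dot_swap]
  refine Eq.trans (congrArg _ (funext fun j => ?_)) (dot_zero u)
  exact dot_dot_antisymm u fun l m => S.weyl.swap_right j k l m

lemma tr_electric (S : IsTwistedWeyl d g h Γ u w f C E) : tr h E = 0 := by
  have e : E = fun k l => dot u fun j => dot u (C j k l) := funext₂ fun k l => S.electric k l
  have e1 : ∀ j m, tr h (fun k l => C j k l m) = 0 := fun j m => by
    rw [← neg_zero, ← S.weyl.trace j m, ← tr_neg]
    exact congrArg _ (funext₂ fun k l => S.weyl.swap_left _ _ _ _)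
  rw [e, tr_dot]
  simp only [tr_dot, e1, dot_zero]

lemma cov_electric_symm (S : IsTwistedWeyl d g h Γ u w f C E) (i k l : ι) :
    cov2 d Γ E i k l = cov2 d Γ E i l k := by
  unfold cov2
  rw [S.electric_symm k l]
  have e1 : (fun p => E p l) = fun p => E l p := funext fun p => S.electric_symm _ _
  have e2 : (fun p => E k p) = fun p => E p k := funext fun p => S.electric_symm _ _
  rw [e1, e2]
  ring

/-- The derivative of E(·, u) = 0. -/
lemma dot_cov_electric (S : IsTwistedWeyl d g h Γ u w f C E) (i k : ι) :
    dot u (cov2 d Γ E i k) = -(f * E i k) := by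
  rw [dot_cov2 (S.torse.covU S.connection)]
  simp only [S.dot_electric, cov1, map_zero, dot_zero]
  rw [S.electric_symm]
  ring

lemma dot_cov_electric' (S : IsTwistedWeyl d g h Γ u w f C E) (i k : ι) :
    dot u (fun j => cov2 d Γ E i j k) = -(f * E i k) := by
  rw [← S.dot_cov_electric]
  exact congrArg _ (funext fun j => S.cov_electric_symm _ _ _)

/-- The derivative of the magnetic identity; ∇u brings back the full `C`, and ∇w the products of `g`
and `E`. -/
lemma dot_cov_weyl (S : IsTwistedWeyl d g h Γ u w f C E) (i j k l : ι) :
    dot u (cov4 d Γ C i j k l) = f * (g i k * E j l - g i j * E k l - C j k l i)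
      + w k * cov2 d Γ E i j l - w j * cov2 d Γ E i k l := by
  have e3 : ∀ i a, d i (w a) = f * (g i a + w i * w a) + dot (Γ i a) w := fun i a => by
    rw [← S.torse.cov]
    unfold cov1
    ring
  rw [dot_cov4 (S.torse.covU S.connection)]
  simp only [S.magnetic]
  unfold cov3 cov2
  simp only [map_sub, Derivation.leibniz, smul_eq_mul, dot_sub, dot_const_mul, dot_mul_const, e3]
  ring

lemma dot_cov_weyl' (S : IsTwistedWeyl d g h Γ u w f C E) (p k l m : ι) :
    dot u (fun i => cov4 d Γ C p i k l m) = -(f * (g p m * E l k - g p l * E m k - C l m k p)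
      + w m * cov2 d Γ E p l k - w l * cov2 d Γ E p m k) := by
  rw [← S.dot_cov_weyl, ← dot_neg]
  refine congrArg _ (funext fun i => ?_)
  rw [(S.weyl.cov S.connection p).pair, (S.weyl.cov S.connection p).swap_right]

lemma div_weyl_antisymm (S : IsTwistedWeyl d g h Γ u w f C E) (i k m : ι) :
    tr h (fun p q => cov4 d Γ C p i k m q) = -tr h (fun p q => cov4 d Γ C p k i m q) := by
  rw [← tr_neg]
  exact congrArg _ (funext₂ fun p q => (S.weyl.cov S.connection p).swap_left _ _ _ _)

lemma dot_div_weyl (S : IsTwistedWeyl d g h Γ u w f C E) (i k : ι) :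
    dot u (fun m => tr h fun p q => cov4 d Γ C p i k m q) =
      w i * tr h (fun p q => cov2 d Γ E p k q) - w k * tr h (fun p q => cov2 d Γ E p i q) := by
  have hs := S.connection.h_symm
  have e1 : tr h (fun p q => C i k q p) = 0 :=
    tr_antisymm hs fun a b => S.weyl.swap_right _ _ _ _
  have e2 : tr h (fun p q => dot u (cov4 d Γ C p i k q)) =
      f * (tr h (fun p q => g p k * E i q) - tr h (fun p q => g p i * E k q)
        - tr h (fun p q => C i k q p))
      + w k * tr h (fun p q => cov2 d Γ E p i q) - w i * tr h (fun p q => cov2 d Γ E p k q) := by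
    simp only [← tr_add, ← tr_sub, ← tr_const_mul, S.dot_cov_weyl]
  have e3 : dot u (fun m => tr h fun p q => cov4 d Γ C p i k m q)
      = -tr h (fun p q => dot u (cov4 d Γ C p i k q)) := by
    rw [← tr_dot, ← tr_neg]
    refine congrArg _ (funext₂ fun p q => ?_)
    rw [← dot_neg]
    exact congrArg _ (funext fun m => (S.weyl.cov S.connection p).swap_right _ _ _ _)
  rw [e3, e2, e1, S.connection.tr_g_left, S.connection.tr_g_left, S.electric_symm k i]
  ring

/-- Trace of `dot_cov_weyl'`. The factor n - 1 is tr g = n, less one for the trace of g ⊗ E; the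
term in `C` is trace-free. -/
lemma dot_div_weyl' (S : IsTwistedWeyl d g h Γ u w f C E) (i l : ι) :
    dot u (fun j => tr h fun p q => cov4 d Γ C p j i l q) =
      -(((Fintype.card ι : R) - 1) * (f * E i l)) - dot u (fun p => cov2 d Γ E p i l)
        + w l * tr h (fun p q => cov2 d Γ E p i q) := by
  have hs := S.connection.h_symm
  have e1 : tr h (fun p q => C l q i p) = 0 := by
    rw [← S.weyl.trace l i, ← tr_transpose hs]
    refine congrArg _ (funext₂ fun p q => ?_)
    rw [S.weyl.swap_left, S.weyl.swap_right, neg_neg]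
  have e2 : tr h (fun p q => dot u fun j => cov4 d Γ C p j i l q) =
      -(f * (tr h g * E l i - tr h (fun p q => g p l * E q i) - tr h (fun p q => C l q i p))
      + tr h (fun p q => cov2 d Γ E p l i * w q) - w l * tr h (fun p q => cov2 d Γ E p q i)) := by
    simp only [← tr_add, ← tr_sub, ← tr_const_mul, ← tr_mul_const, ← tr_neg, S.dot_cov_weyl']
    exact congrArg _ (funext₂ fun p q => by ring)
  have e4 : tr h (fun p q => cov2 d Γ E p l i * w q) = dot u (fun p => cov2 d Γ E p i l) := by
    simp only [← S.torse.lower]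
    rw [S.connection.tr_lower_right]
    exact congrArg _ (funext fun p => S.cov_electric_symm _ _ _)
  have e5 : tr h (fun p q => cov2 d Γ E p q i) = tr h (fun p q => cov2 d Γ E p i q) :=
    congrArg _ (funext₂ fun p q => S.cov_electric_symm _ _ _)
  rw [← tr_dot, e2, e1, e4, e5, S.connection.tr_g_left (fun q => E q i), S.connection.tr_g,
    S.electric_symm l i]
  ring

lemma dot_div_electric (S : IsTwistedWeyl d g h Γ u w f C E) :
    dot u (fun k => tr h fun p q => cov2 d Γ E p k q) = 0 := by
  rw [← tr_dot]
  simp only [S.dot_cov_electric', tr_neg, tr_const_mul]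
  rw [S.tr_electric]
  ring

/-- The divergence of the Weyl tensor in terms of its electric part. -/
theorem div_weyl (S : IsTwistedWeyl d g h Γ u w f C E) (i k m : ι) :
    tr h (fun p q => cov4 d Γ C p i k m q) =
      ((Fintype.card ι : R) - 3) * (cov2 d Γ E i k m - cov2 d Γ E k i m)
      + ((Fintype.card ι : R) - 2) *
        (w i * dot u (fun p => cov2 d Γ E p k m) - w k * dot u (fun p => cov2 d Γ E p i m)
          + 2 * f * (w i * E k m - w k * E i m))
      + (2 * w k * w m + g k m) * tr h (fun p q => cov2 d Γ E p i q)
      - (2 * w i * w m + g i m) * tr h (fun p q => cov2 d Γ E p k q) := by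
  -- The Weyl–Bianchi identity contracted with uᵐ. The terms in `f` cancel by the cyclic identity of
  -- `C` and the symmetry of `E` and `g`.
  have h1 : ∀ j l, ((Fintype.card ι : R) - 3) *
      (w k * cov2 d Γ E i j l - w j * cov2 d Γ E i k l + w i * cov2 d Γ E j k l
        - w k * cov2 d Γ E j i l + w j * cov2 d Γ E k i l - w i * cov2 d Γ E k j l) =
      g j l * (w i * tr h (fun p q => cov2 d Γ E p k q) - w k * tr h (fun p q => cov2 d Γ E p i q))
      - w j * tr h (fun p q => cov4 d Γ C p i k l q)
      + g k l * (w j * tr h (fun p q => cov2 d Γ E p i q) - w i * tr h (fun p q => cov2 d Γ E p j q))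
      - w k * tr h (fun p q => cov4 d Γ C p j i l q)
      + g i l * (w k * tr h (fun p q => cov2 d Γ E p j q) - w j * tr h (fun p q => cov2 d Γ E p k q))
      + w i * tr h (fun p q => cov4 d Γ C p j k l q) := by
    intro j l
    have e := congrArg (dot u) (funext fun m => S.bianchi i j k l m)
    simp only [dot_add, dot_sub, dot_const_mul, dot_mul_const] at e
    simp only [S.dot_div_weyl, S.torse.lower] at e
    have e1 := S.dot_cov_weyl i j k l
    have e2 := S.dot_cov_weyl j k i l
    have e3 := S.dot_cov_weyl k i j l
    rw [e1, e2, e3, S.connection.g_symm j i, S.connection.g_symm k i, S.connection.g_symm k j] at e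
    rw [S.weyl.swap_right j k l i, S.weyl.swap_right k i l j, S.weyl.swap_right i j l k] at e
    linear_combination e - ((Fintype.card ι : R) - 3) * f * S.weyl.cyclic i j k l
      - w i * S.div_weyl_antisymm k j l
  -- Now contract with uʲ: the divergence multiplied by wⱼ gets coefficient 1, and the others become
  -- the known `dot_div_weyl'`.
  have e := congrArg (dot u) (funext fun j => h1 j m)
  simp only [dot_add, dot_sub, dot_const_mul, dot_mul_const] at e
  have e1 : dot u (fun p => g p m) = w m := by
    rw [← S.torse.lower]
    exact congrArg _ (funext fun p => S.connection.g_symm _ _)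
  rw [S.dot_cov_electric', S.dot_cov_electric', e1, S.dot_div_weyl', S.dot_div_weyl',
    S.dot_div_electric] at e
  rw [S.torse.unit] at e
  linear_combination -e

/-- Contract the Weyl–Bianchi identity with `u` in the derivative slot. Divergences contracted with
`u` are known; the remaining one, multiplied by `w`, is given by `div_weyl`. -/
lemma dot_cov4_electric (S : IsTwistedWeyl d g h Γ u w f C E) (j k l m : ι) :
    ((Fintype.card ι : R) - 3) *
        (dot u (fun p => cov4 d Γ C p j k l m) + 2 * f * C j k l m) =
      ((Fintype.card ι : R) - 2) *
        (kn (fun a b => w a * w b) (fun a b => dot u fun p => cov2 d Γ E p a b) j k l m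
          + 2 * f * kn (fun a b => w a * w b) E j k l m)
      + (kn g (fun a b => dot u fun p => cov2 d Γ E p a b) j k l m
          + 2 * f * kn g E j k l m) := by
  have e := congrArg (dot u) (funext fun i => S.bianchi i j k l m)
  have e1 : ∀ l, dot u (fun p => g p l) = w l := fun l => by
    rw [← S.torse.lower]
    exact congrArg _ (funext fun p => S.connection.g_symm _ _)
  have e2 : dot u (fun i => cov4 d Γ C j k i l m) = -dot u (fun i => cov4 d Γ C j i k l m) := by
    rw [← dot_neg]
    exact congrArg _ (funext fun p => (S.weyl.cov S.connection j).swap_left _ _ _ _)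
  simp only [dot_add, dot_sub, dot_const_mul, dot_mul_const] at e
  rw [e2, S.dot_cov_weyl', S.dot_cov_weyl', e1, e1, S.dot_div_weyl', S.dot_div_weyl'] at e
  have e3 : ∀ i m, dot u (fun a => tr h fun p q => cov4 d Γ C p i a m q) =
      -dot u (fun a => tr h fun p q => cov4 d Γ C p a i m q) := fun i m => by
    rw [← dot_neg]
    exact congrArg _ (funext fun p => S.div_weyl_antisymm _ _ _)
  rw [e3, e3, S.dot_div_weyl', S.dot_div_weyl', S.div_weyl k j m, S.div_weyl k j l,
    S.weyl.pair l m k j, S.weyl.swap_left k j l m, S.weyl.pair l m j k, S.cov_electric_symm j l k,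
    S.cov_electric_symm j m k, S.cov_electric_symm k l j, S.cov_electric_symm k m j,
    S.electric_symm l k, S.electric_symm m k, S.electric_symm l j, S.electric_symm m j] at e
  unfold kn
  linear_combination e

end IsTwistedWeyl

/-- The Christoffel symbols are the Levi-Civita connection. -/
lemma isLeviCivita_christoffel (hd : ∀ i j x, d i (d j x) = d j (d i x))
    (hg : ∀ a b, g a b = g b a) (hh : ∀ a b, h a b = h b a)
    (hinv : ∀ a b, dot (h a) (g b) = if a = b then 1 else 0) {c : R} (hc : 2 * c = 1)
    (hΓ : ∀ i j p, Γ i j p = c * dot (h p) fun l => d i (g j l) + d j (g i l) - d l (g i j)) :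
    IsLeviCivita d g h Γ where
  comm := hd
  g_symm := hg
  h_symm := hh
  inv := hinv
  Γ_symm i j p := by
    rw [hΓ, hΓ]
    refine congrArg _ (congrArg _ (funext fun l => ?_))
    rw [hg i j]
    ring
  compat i a b := by
    have e : ∀ a b, dot (Γ i a) (fun p => g p b) =
        c * (d i (g a b) + d a (g i b) - d b (g i a)) := fun a b => by
      have e1 : Γ i a = fun p => c * dot (h p) fun l => d i (g a l) + d a (g i l) - d l (g i a) :=
        funext fun p => hΓ i a p
      have e2 : (fun p => g p b) = g b := funext fun p => hg p b
      have e3 : ∀ l, dot (g b) (fun p => h p l) = if b = l then 1 else 0 := fun l => by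
        rw [dot_comm]
        have e4 : (fun p => h p l) = h l := funext fun p => hh p l
        rw [e4, hinv]
        simp only [eq_comm]
      rw [e1, e2, dot_comm, dot_const_mul, dot_dot]
      simp only [e3]
      simp [dot]
    have e2 : (fun p => g a p) = fun p => g p a := funext fun p => hg a p
    unfold cov2
    rw [e2, e, e, hg b a]
    linear_combination -d i (g a b) * hc

/-- `hc₁` and `hc₂` say that the coefficients of `Ric` and of `tr h Ric * g` in the trace vanish. -/
lemma tr_add_kn (H : IsLeviCivita d g h Γ) {Ric : ι → ι → R} {c₁ c₂ : R}
    (hc₁ : ((Fintype.card ι : R) - 2) * c₁ = 1)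
    (hc₂ : ((Fintype.card ι : R) - 2) * c₂ = c₁ - Fintype.card ι * c₂)
    (hRic : ∀ k m, Ric k m = tr h fun j l => curv d g Γ j k l m)
    (hP : ∀ k m, P k m = c₁ * Ric k m - c₂ * tr h Ric * g k m)
    (hC : ∀ i j k m, C i j k m = curv d g Γ i j k m + kn g P i j k m) (k m : ι) :
    tr h (fun j l => C j k l m) = 0 := by
  have e1 : tr h (fun j l => g j m * P k l) = P k m := H.tr_g_left (fun l => P k l) m
  have e2 : tr h (fun j l => P j m * g k l) = P k m := by
    rw [← H.tr_g_right (fun j => P j m) k]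
    exact congrArg _ (funext₂ fun j l => by rw [H.g_symm])
  have e3 : tr h P = c₁ * tr h Ric - c₂ * tr h Ric * tr h g := by
    rw [← tr_const_mul, ← tr_const_mul, ← tr_sub]
    exact congrArg _ (funext₂ hP)
  have e4 : tr h (fun j l => C j k l m) = tr h (fun j l => curv d g Γ j k l m)
      + tr h (fun j l => g j m * P k l) - g k m * tr h P - tr h g * P k m
      + tr h (fun j l => P j m * g k l) := by
    simp only [← tr_add, ← tr_sub, ← tr_mul_const, ← tr_const_mul]
    refine congrArg _ (funext₂ fun j l => ?_)
    rw [hC]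
    unfold kn
    ring
  rw [e4, ← hRic, e1, e2, e3, hP, H.tr_g]
  linear_combination -Ric k m * hc₁ + g k m * tr h Ric * hc₂

lemma isTwistedWeyl (H : IsLeviCivita d g h Γ) (T : IsTorseForming d g Γ u w f)
    (hn : 2 < Fintype.card ι) {Ric : ι → ι → R} {c₁ c₂ : R}
    (hc₁ : ((Fintype.card ι : R) - 2) * c₁ = 1)
    (hc₂ : ((Fintype.card ι : R) - 2) * c₂ = c₁ - Fintype.card ι * c₂)
    (hRic : ∀ k m, Ric k m = tr h fun j l => curv d g Γ j k l m)
    (hP : ∀ k m, P k m = c₁ * Ric k m - c₂ * tr h Ric * g k m)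
    (hC : ∀ i j k m, C i j k m = curv d g Γ i j k m + kn g P i j k m)
    (hE : ∀ k l, E k l = dot u fun j => dot u (C j k l)) :
    IsTwistedWeyl d g h Γ u w f C E := by
  have hRs : ∀ k m, Ric k m = Ric m k := fun k m => by
    rw [hRic, hRic, ← tr_transpose H.h_symm]
    exact congrArg _ (funext₂ fun j l => H.curv_pair _ _ _ _)
  have hPs : ∀ a b, P a b = P b a := fun a b => by rw [hP, hP, hRs, H.g_symm]
  have htr := tr_add_kn H hc₁ hc₂ hRic hP hC
  exact
    { connection := H
      torse := T
      weyl := isWeylTensor_add_kn H hPs hC htr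
      electric := hE
      magnetic := T.dot_weyl H hn hC htr hE
      bianchi := weyl_bianchi_div H hn hPs hC htr fun _ _ _ => rfl }

namespace IsTwistedWeyl

/-- `u` is geodesic: uᵖ(gₚᵢ + wₚwᵢ) = wᵢ - wᵢ = 0, so no derivative of `w` survives. -/
lemma dot_cov3_electric (S : IsTwistedWeyl d g h Γ u w f C E) (i k m : ι) :
    dot u (fun p => cov3 d Γ (fun i k m => w i * E k m - w k * E i m) p i k m) =
      w i * dot u (fun p => cov2 d Γ E p k m) - w k * dot u (fun p => cov2 d Γ E p i m) := by
  have e3 : ∀ i a, d i (w a) = f * (g i a + w i * w a) + dot (Γ i a) w := fun i a => by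
    rw [← S.torse.cov]
    unfold cov1
    ring
  have e1 : ∀ l, dot u (fun p => g p l) = w l := fun l => by
    rw [← S.torse.lower]
    exact congrArg _ (funext fun p => S.connection.g_symm _ _)
  have e : ∀ p, cov3 d Γ (fun i k m => w i * E k m - w k * E i m) p i k m =
      w i * cov2 d Γ E p k m - w k * cov2 d Γ E p i m
      + f * ((g p i + w p * w i) * E k m - (g p k + w p * w k) * E i m) := fun p => by
    unfold cov3 cov2
    simp only [map_sub, Derivation.leibniz, smul_eq_mul, dot_sub, dot_const_mul, dot_mul_const, e3]
    ring
  simp only [e, dot_add, dot_sub, dot_const_mul, dot_mul_const, e1, S.torse.unit]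
  ring

lemma dot_cov4_kn_metric (S : IsTwistedWeyl d g h Γ u w f C E) (j k l m : ι) :
    dot u (fun p => cov4 d Γ (kn g E) p j k l m) =
      kn g (fun a b => dot u fun p => cov2 d Γ E p a b) j k l m := by
  have e : ∀ i, cov2 d Γ g i = fun _ _ => 0 := fun i =>
    funext₂ fun a b => S.connection.compat i a b
  simp only [cov4_kn, e]
  unfold kn
  simp

lemma dot_cov4_kn_velocity (S : IsTwistedWeyl d g h Γ u w f C E) (j k l m : ι) :
    dot u (fun p => cov4 d Γ (kn (fun a b => w a * w b) E) p j k l m) =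
      kn (fun a b => w a * w b) (fun a b => dot u fun p => cov2 d Γ E p a b) j k l m := by
  have e3 : ∀ i a, d i (w a) = f * (g i a + w i * w a) + dot (Γ i a) w := fun i a => by
    rw [← S.torse.cov]
    unfold cov1
    ring
  have e1 : ∀ l, dot u (fun p => g p l) = w l := fun l => by
    rw [← S.torse.lower]
    exact congrArg _ (funext fun p => S.connection.g_symm _ _)
  have e : ∀ i, cov2 d Γ (fun a b => w a * w b) i =
      fun a b => f * ((g i a + w i * w a) * w b + w a * (g i b + w i * w b)) := fun i =>
    funext₂ fun a b => by
      unfold cov2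
      simp only [Derivation.leibniz, smul_eq_mul, dot_const_mul, dot_mul_const, e3]
      ring
  simp only [cov4_kn, e]
  unfold kn
  simp only [dot_add, dot_sub, dot_const_mul, dot_mul_const, e1, S.torse.unit]
  ring

end IsTwistedWeyl

end Electric

end IndexCalculus

/-! ### Smooth functions on an open set -/

open CoordTensor IndexCalculus
open scoped ContDiff

section SmoothRing

variable {n : ℕ}

/-- The smooth functions on an open set of the coordinate space. -/
def smoothRing (T : TopologicalSpace.Opens (Coord n)) : Subalgebra ℝ (T → ℝ) where
  carrier := {F | ∃ F' : Coord n → ℝ, ContDiffOn ℝ ∞ F' T ∧ ∀ z : T, F z = F' z}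
  mul_mem' := by
    rintro F₁ F₂ ⟨F₁', h₁, e₁⟩ ⟨F₂', h₂, e₂⟩
    exact ⟨fun z => F₁' z * F₂' z, h₁.mul h₂, fun z => by simp [e₁, e₂]⟩
  add_mem' := by
    rintro F₁ F₂ ⟨F₁', h₁, e₁⟩ ⟨F₂', h₂, e₂⟩
    exact ⟨fun z => F₁' z + F₂' z, h₁.add h₂, fun z => by simp [e₁, e₂]⟩
  algebraMap_mem' c := ⟨fun _ => c, contDiffOn_const, fun _ => rfl⟩

namespace smoothRing

variable {T : TopologicalSpace.Opens (Coord n)}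

/-- The restriction to `T` of a function that is smooth there. -/
def mk (F : Coord n → ℝ) (hF : ContDiffOn ℝ ∞ F T) : smoothRing T :=
  ⟨fun z => F z, F, hF, fun _ => rfl⟩

/-- Evaluation at a point. -/
def ev (z : T) : smoothRing T →ₐ[ℝ] ℝ := (Pi.evalAlgHom ℝ (fun _ : T => ℝ) z).comp (smoothRing T).val

@[simp] lemma ev_mk (F : Coord n → ℝ) (hF : ContDiffOn ℝ ∞ F T) (z : T) : ev z (mk F hF) = F z := rfl

lemma ext_ev {x y : smoothRing T} (hxy : ∀ z, ev z x = ev z y) : x = y :=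
  Subtype.ext (funext hxy)

/-- A smooth extension to the coordinate space, with arbitrary values outside of `T`. -/
noncomputable def lift (x : smoothRing T) : Coord n → ℝ := x.2.choose

lemma contDiffOn_lift (x : smoothRing T) : ContDiffOn ℝ ∞ (lift x) T := x.2.choose_spec.1

lemma lift_apply (x : smoothRing T) (z : T) : lift x z = ev z x := (x.2.choose_spec.2 z).symm

/-- As `T` is open, derivatives on `T` do not depend on the extension chosen by `lift`. -/
lemma pd_congr {F₁ F₂ : Coord n → ℝ} (hF : ∀ z ∈ T, F₁ z = F₂ z) (i : Fin n) (z : T) :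
    pd i F₁ z = pd i F₂ z := by
  unfold pd
  rw [Filter.EventuallyEq.fderiv_eq (Filter.eventuallyEq_of_mem (T.isOpen.mem_nhds z.2) hF)]

lemma contDiffOn_pd {F : Coord n → ℝ} (hF : ContDiffOn ℝ ∞ F T) (i : Fin n) :
    ContDiffOn ℝ ∞ (pd i F) T :=
  (hF.fderiv_of_isOpen T.isOpen (m := ∞) (by simp)).clm_apply contDiffOn_const

lemma differentiableAt_lift (x : smoothRing T) (z : T) : DifferentiableAt ℝ (lift x) z :=
  ((contDiffOn_lift x).contDiffAt (T.isOpen.mem_nhds z.2)).differentiableAt (by simp)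

/-- The partial derivatives as derivations. -/
noncomputable def partialD (i : Fin n) : Derivation ℝ (smoothRing T) (smoothRing T) :=
  Derivation.mk'
    { toFun := fun x => mk (pd i (lift x)) (contDiffOn_pd (contDiffOn_lift x) i)
      map_add' := fun x y => ext_ev fun z => by
        rw [map_add, ev_mk, ev_mk, ev_mk, pd_congr (F₂ := fun z => lift x z + lift y z)]
        · unfold pd
          rw [fderiv_fun_add (differentiableAt_lift x z) (differentiableAt_lift y z)]
          rfl
        · intro z hz
          simp only [lift_apply _ ⟨z, hz⟩, map_add]
      map_smul' := fun c x => ext_ev fun z => by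
        rw [map_smul, ev_mk, RingHom.id_apply, ev_mk, pd_congr (F₂ := fun z => c • lift x z)]
        · unfold pd
          rw [fderiv_fun_const_smul (differentiableAt_lift x z)]
          rfl
        · intro z hz
          simp only [lift_apply _ ⟨z, hz⟩, map_smul] }
    fun x y => ext_ev fun z => by
      change pd i (lift (x * y)) z = ev z (x * mk (pd i (lift y)) (contDiffOn_pd (contDiffOn_lift y) i)
        + y * mk (pd i (lift x)) (contDiffOn_pd (contDiffOn_lift x) i))
      rw [map_add, map_mul, map_mul, ev_mk, ev_mk, pd_congr (F₂ := fun z => lift x z * lift y z)]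
      · unfold pd
        rw [fderiv_fun_mul (differentiableAt_lift x z) (differentiableAt_lift y z)]
        simp [lift_apply]
      · intro z hz
        simp only [lift_apply _ ⟨z, hz⟩, map_mul]

lemma ev_partialD {x : smoothRing T} {F : Coord n → ℝ} (hF : ∀ z : T, ev z x = F z) (i : Fin n)
    (z : T) : ev z (partialD i x) = pd i F z := by
  change pd i (lift x) z = _
  exact pd_congr (fun z hz => (lift_apply x ⟨z, hz⟩).trans (hF ⟨z, hz⟩)) i z

lemma partialD_comm (i j : Fin n) (x : smoothRing T) :
    partialD i (partialD j x) = partialD j (partialD i x) := by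
  refine ext_ev fun z => ?_
  have e : ∀ i j : Fin n, ev z (partialD i (partialD j x)) =
      fderiv ℝ (fderiv ℝ (lift x)) z (EuclideanSpace.single i 1) (EuclideanSpace.single j 1) := by
    intro i j
    rw [ev_partialD (fun z => ev_partialD (F := lift x) (fun z => (lift_apply x z).symm) j z)]
    have h1 : DifferentiableAt ℝ (fderiv ℝ (lift x)) z :=
      (((contDiffOn_lift x).fderiv_of_isOpen T.isOpen (m := ∞) (by simp)).contDiffAt
        (T.isOpen.mem_nhds z.2)).differentiableAt (by simp)
    unfold pd
    rw [fderiv_clm_apply h1 (differentiableAt_const _)]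
    simp
  rw [e, e]
  exact (((contDiffOn_lift x).contDiffAt (T.isOpen.mem_nhds z.2)).isSymmSndFDerivAt
    (by simpa using WithTop.coe_le_coe.mpr (le_top : (2 : ℕ∞) ≤ ⊤))) _ _

lemma ev_dot (z : T) (v X : Fin n → smoothRing T) :
    ev z (dot v X) = ∑ p, ev z (v p) * ev z (X p) := by
  simp [dot]

lemma ev_tr (z : T) (h X : Fin n → Fin n → smoothRing T) :
    ev z (tr h X) = ∑ p, ∑ q, ev z (h p q) * ev z (X p q) := by
  simp [tr, ev_dot]

/-- By Cramer's rule the inverse is the adjugate over the determinant, which is smooth and nowhere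
zero on `T`. -/
lemma exists_inverse {G : Coord n → Matrix (Fin n) (Fin n) ℝ} {g : Fin n → Fin n → smoothRing T}
    (hg : ∀ (z : T) i j, ev z (g i j) = G z i j) (hdet : ∀ z ∈ T, IsUnit (G z).det) :
    ∃ h : Fin n → Fin n → smoothRing T, ∀ (z : T) i j, ev z (h i j) = (G z)⁻¹ i j := by
  have e : ∀ z : T, (Matrix.of g).map (ev z).toRingHom = G z := fun z => by
    ext i j
    exact hg z i j
  have e1 : ∀ z : T, lift (Matrix.of g).det z = (G z).det := fun z => by
    rw [lift_apply, ← e z]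
    exact RingHom.map_det (ev z).toRingHom (Matrix.of g)
  have e2 : ContDiffOn ℝ ∞ (fun z => (lift (Matrix.of g).det z)⁻¹) T :=
    (contDiffOn_lift _).inv fun z hz => by
      rw [e1 ⟨z, hz⟩]
      exact (hdet z hz).ne_zero
  refine ⟨fun i j => mk _ e2 * (Matrix.of g).adjugate i j, fun z i j => ?_⟩
  have e3 := congrFun₂ (RingHom.map_adjugate (ev z).toRingHom (Matrix.of g)) i j
  rw [RingHom.mapMatrix_apply, RingHom.mapMatrix_apply, e z] at e3
  rw [map_mul, ev_mk, e1, Matrix.inv_def, Ring.inverse_eq_inv', Matrix.smul_apply, ← e3]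
  rfl

section Cov

variable {G : Coord n → Matrix (Fin n) (Fin n) ℝ} {Γ : Fin n → Fin n → Fin n → smoothRing T}

lemma ev_cov1 (hΓ : ∀ (z : T) i j p, ev z (Γ i j p) = christoffel G z p i j)
    {X : Fin n → smoothRing T} {X' : Coord n → Fin n → ℝ}
    (hX : ∀ (z : T) a, ev z (X a) = X' z a) (z : T) (i a : Fin n) :
    ev z (cov1 partialD Γ X i a) = covD1 G X' z i a := by
  simp only [cov1, covD1, map_sub, ev_dot, hΓ, hX, ev_partialD (F := fun z => X' z a) fun z => hX z a]

lemma ev_cov2 (hΓ : ∀ (z : T) i j p, ev z (Γ i j p) = christoffel G z p i j)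
    {X : Fin n → Fin n → smoothRing T} {X' : Coord n → Fin n → Fin n → ℝ}
    (hX : ∀ (z : T) a b, ev z (X a b) = X' z a b) (z : T) (i a b : Fin n) :
    ev z (cov2 partialD Γ X i a b) = covD2 G X' z i a b := by
  simp only [cov2, covD2, map_sub, ev_dot, hΓ, hX, ev_partialD (F := fun z => X' z a b) fun z => hX z a b]

lemma ev_cov3 (hΓ : ∀ (z : T) i j p, ev z (Γ i j p) = christoffel G z p i j)
    {X : Fin n → Fin n → Fin n → smoothRing T} {X' : Coord n → Fin n → Fin n → Fin n → ℝ}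
    (hX : ∀ (z : T) a b c, ev z (X a b c) = X' z a b c) (z : T) (i a b c : Fin n) :
    ev z (cov3 partialD Γ X i a b c) = covD3 G X' z i a b c := by
  simp only [cov3, covD3, map_sub, ev_dot, hΓ, hX, ev_partialD (F := fun z => X' z a b c) fun z => hX z a b c]

lemma ev_cov4 (hΓ : ∀ (z : T) i j p, ev z (Γ i j p) = christoffel G z p i j)
    {X : Fin n → Fin n → Fin n → Fin n → smoothRing T}
    {X' : Coord n → Fin n → Fin n → Fin n → Fin n → ℝ}
    (hX : ∀ (z : T) a b c e, ev z (X a b c e) = X' z a b c e) (z : T) (i a b c e : Fin n) :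
    ev z (cov4 partialD Γ X i a b c e) = covD4 G X' z i a b c e := by
  simp only [cov4, covD4, map_sub, ev_dot, hΓ, hX, ev_partialD (F := fun z => X' z a b c e) fun z => hX z a b c e]

end Cov

end smoothRing

end SmoothRing

/-! ### The identities in coordinates on an open set. -/

open smoothRing

lemma ricciFactor_trace {n : ℕ} (hn : 3 < n) :
    ((n : ℝ) - 2) * (1 / ((n : ℝ) - 2)) = 1 ∧
    ((n : ℝ) - 2) * (1 / (2 * (((n : ℝ) - 1) * ((n : ℝ) - 2)))) =
      1 / ((n : ℝ) - 2) - n * (1 / (2 * (((n : ℝ) - 1) * ((n : ℝ) - 2)))) := by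
  have h3 : (3 : ℝ) < n := by exact_mod_cast hn
  have h1 : (n : ℝ) - 2 ≠ 0 := by linarith
  have h2 : (n : ℝ) - 1 ≠ 0 := by linarith
  constructor
  · field_simp
  · field_simp
    ring

set_option maxHeartbeats 1600000 in
/-- The two identities of the Weyl tensor, for a metric, a vector field and a scalar given in
coordinates on an open set. -/
theorem weyl_identities_coord {n : ℕ} (hn : 3 < n) (T : TopologicalSpace.Opens (Coord n))
    (G : Coord n → Matrix (Fin n) (Fin n) ℝ) (U : Coord n → Fin n → ℝ) (F : Coord n → ℝ)
    (hG : ∀ i j, ContDiffOn ℝ ∞ (fun z => G z i j) T)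
    (hU : ∀ i, ContDiffOn ℝ ∞ (fun z => U z i) T) (hF : ContDiffOn ℝ ∞ F T)
    (hsymm : ∀ z ∈ T, ∀ i j, G z i j = G z j i) (hdet : ∀ z ∈ T, IsUnit (G z).det)
    (hunit : ∀ z ∈ T, ∑ i, U z i * lower G U z i = -1)
    (htorse : ∀ z ∈ T, ∀ i j, covD1 G (lower G U) z i j =
      F z * (G z i j + lower G U z i * lower G U z j)) (y : Coord n) (hy : y ∈ T) :
    (∀ i k m : Fin n,
      div4 G (weyl G) y i k m =
        ((n : ℝ) - 3) * (covD2 G (electric G U) y i k m - covD2 G (electric G U) y k i m)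
        + ((n : ℝ) - 2) *
          (dirD3 G U (fun z i k m => lower G U z i * electric G U z k m
              - lower G U z k * electric G U z i m) y i k m
            + 2 * F y * (lower G U y i * electric G U y k m - lower G U y k * electric G U y i m))
        + (2 * lower G U y k * lower G U y m + G y k m) * div2 G (electric G U) y i
        - (2 * lower G U y i * lower G U y m + G y i m) * div2 G (electric G U) y k) ∧
    (∀ i k l m : Fin n,
      ((n : ℝ) - 3) * (dirD4 G U (weyl G) y i k l m + 2 * F y * weyl G y i k l m) =
        ((n : ℝ) - 2) *
          (dirD4 G U (kulkarniNomizu (fun z a b => lower G U z a * lower G U z b)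
              (electric G U)) y i k l m
            + 2 * F y * kulkarniNomizu (fun z a b => lower G U z a * lower G U z b)
              (electric G U) y i k l m)
        + (dirD4 G U (kulkarniNomizu G (electric G U)) y i k l m
            + 2 * F y * kulkarniNomizu G (electric G U) y i k l m)) := by
  set g : Fin n → Fin n → smoothRing T := fun i j => smoothRing.mk _ (hG i j) with hg
  have eg : ∀ (z : T) i j, ev z (g i j) = G z i j := fun z i j => rfl
  obtain ⟨h, eh⟩ := exists_inverse eg hdet
  set u : Fin n → smoothRing T := fun i => smoothRing.mk _ (hU i) with hu
  have eu : ∀ (z : T) i, ev z (u i) = U z i := fun z i => rfl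
  set f : smoothRing T := smoothRing.mk F hF with hf
  have ef : ∀ z : T, ev z f = F z := fun z => rfl
  clear_value g u f
  set w : Fin n → smoothRing T := fun a => dot u (g a) with hw
  have ew : ∀ (z : T) a, ev z (w a) = lower G U z a := fun z a => by
    simp only [hw, ev_dot, eg, eu, lower, mul_comm]
  set Γ : Fin n → Fin n → Fin n → smoothRing T := fun i j p => algebraMap ℝ _ (1 / 2) *
    dot (h p) fun l => partialD i (g j l) + partialD j (g i l) - partialD l (g i j) with hΓ
  have eΓ : ∀ (z : T) i j p, ev z (Γ i j p) = christoffel G z p i j := fun z i j p => by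
    simp only [hΓ, map_mul, AlgHom.commutes, ev_dot, eh, map_sub, map_add, christoffel,
      fun i a b => ev_partialD (F := fun z => G z a b) (fun z => eg z a b) i z]
    rfl
  have eup : ∀ (z : T) i j k m, ev z (curvUp partialD Γ i j k m) = riemannUp G z i j k m :=
    fun z i j k m => by
      simp only [curvUp, riemannUp, map_add, map_sub, ev_dot, eΓ, fun i a b c =>
        ev_partialD (F := fun z => christoffel G z c a b) (fun z => eΓ z a b c) i z,
        Finset.sum_sub_distrib, mul_comm]
  have ecurv : ∀ (z : T) i j k m, ev z (curv partialD g Γ i j k m) = riemann G z i j k m :=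
    fun z i j k m => by simp only [curv, riemann, ev_dot, eup, eg]
  set Ric : Fin n → Fin n → smoothRing T := fun k m => tr h fun j l => curv partialD g Γ j k l m
    with hRic
  have eRic : ∀ (z : T) k m, ev z (Ric k m) = ricci G z k m := fun z k m => by
    simp only [hRic, ev_tr, ecurv, eh, ricci]
  have eSc : ∀ z : T, ev z (tr h Ric) = scalar G z := fun z => by
    simp only [ev_tr, eRic, eh, scalar]
  -- The Schouten tensor. The extra 2 in the denominator is there because `kn g g` counts each
  -- product of metrics twice.
  set P : Fin n → Fin n → smoothRing T := fun k m => algebraMap ℝ _ (1 / ((n : ℝ) - 2)) * Ric k m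
    - algebraMap ℝ _ (1 / (2 * (((n : ℝ) - 1) * ((n : ℝ) - 2)))) * tr h Ric * g k m with hP
  have eP : ∀ (z : T) k m, ev z (P k m) = 1 / ((n : ℝ) - 2) * ricci G z k m
      - 1 / (2 * (((n : ℝ) - 1) * ((n : ℝ) - 2))) * scalar G z * G z k m := fun z k m => by
    simp only [hP, map_sub, map_mul, AlgHom.commutes, eRic, eSc, eg]
    rfl
  clear_value Ric
  set C : Fin n → Fin n → Fin n → Fin n → smoothRing T := fun i j k m =>
    curv partialD g Γ i j k m + kn g P i j k m with hC
  have eC : ∀ (z : T) i j k m, ev z (C i j k m) = weyl G z i j k m := fun z i j k m => by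
    simp only [hC, kn, map_add, map_sub, map_mul, ecurv, eP, eg, weyl]
    have h2 : (2 * (((n : ℝ) - 1) * ((n : ℝ) - 2)))⁻¹ =
      2⁻¹ * (((n : ℝ) - 1) * ((n : ℝ) - 2))⁻¹ := mul_inv _ _
    simp only [div_eq_mul_inv, one_mul, h2]
    ring
  set E : Fin n → Fin n → smoothRing T := fun k l => dot u fun j => dot u (C j k l) with hE
  have eE : ∀ (z : T) k l, ev z (E k l) = electric G U z k l := fun z k l => by
    simp only [hE, ev_dot, eu, eC, electric, Finset.mul_sum, mul_assoc]
  have hinv : ∀ a b, dot (h a) (g b) = if a = b then 1 else 0 := fun a b => ext_ev fun z => by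
    have h1 := congrFun₂ (Matrix.nonsing_inv_mul (G z) (hdet z z.2)) a b
    rw [Matrix.mul_apply, Matrix.one_apply] at h1
    simp only [ev_dot, eh, eg, hsymm z z.2 b]
    rw [h1]
    split_ifs <;> simp
  have hh : ∀ a b, h a b = h b a := fun a b => ext_ev fun z => by
    have h1 : (G z).transpose = G z := Matrix.ext fun i j => hsymm z z.2 j i
    have h2 := congrFun₂ (Matrix.transpose_nonsing_inv (G z)) a b
    rw [h1, Matrix.transpose_apply] at h2
    rw [eh, eh, h2]
  have H : IsLeviCivita partialD g h Γ :=
    isLeviCivita_christoffel partialD_comm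
      (fun a b => ext_ev fun z => by rw [eg, eg, hsymm z z.2]) hh hinv
      (c := algebraMap ℝ _ (1 / 2))
      (by rw [← map_ofNat (algebraMap ℝ (smoothRing T)) 2, ← map_mul]; norm_num)
      fun i j p => rfl
  have hT : IsTorseForming (R := smoothRing T) partialD g Γ u w f :=
    { lower := fun a => rfl
      unit := ext_ev fun z => by simp only [ev_dot, eu, ew, hunit z z.2, map_neg, map_one]
      cov := fun i j => ext_ev fun z => by
        rw [ev_cov1 eΓ ew, htorse z z.2]
        simp only [map_mul, map_add, ef, eg, ew] }
  obtain ⟨hc₁, hc₂⟩ := ricciFactor_trace hn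
  have hcard : ((Fintype.card (Fin n) : ℕ) : smoothRing T) = algebraMap ℝ _ (n : ℝ) := by
    rw [Fintype.card_fin, map_natCast]
  have S : IsTwistedWeyl partialD g h Γ u w f C E := by
    refine isTwistedWeyl H hT (by simp; omega) (P := P) (Ric := Ric)
      (c₁ := algebraMap ℝ _ (1 / ((n : ℝ) - 2)))
      (c₂ := algebraMap ℝ _ (1 / (2 * (((n : ℝ) - 1) * ((n : ℝ) - 2))))) ?_ ?_
      (fun k m => by rw [hRic]) (fun k m => rfl) (fun i j k m => rfl) (fun k l => rfl)
    · rw [hcard, ← map_ofNat (algebraMap ℝ (smoothRing T)) 2, ← map_sub, ← map_mul, hc₁, map_one]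
    · rw [hcard, ← map_ofNat (algebraMap ℝ (smoothRing T)) 2, ← map_sub, ← map_mul, ← map_mul,
        ← map_sub, hc₂]
  clear_value w Γ P C E
  have eknw : ∀ (z : T) i k l m, ev z (kn (fun a b => w a * w b) E i k l m) =
      kulkarniNomizu (fun z a b => lower G U z a * lower G U z b) (electric G U) z i k l m :=
    fun z i k l m => by simp only [kn, kulkarniNomizu, map_add, map_sub, map_mul, ew, eE]
  have ekng : ∀ (z : T) i k l m, ev z (kn g E i k l m) =
      kulkarniNomizu G (electric G U) z i k l m :=
    fun z i k l m => by simp only [kn, kulkarniNomizu, map_add, map_sub, map_mul, eg, eE]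
  constructor
  · intro i k m
    have e := S.div_weyl i k m
    rw [← S.dot_cov3_electric] at e
    have e1 := congrArg (ev ⟨y, hy⟩) e
    have e3 : ∀ (z : T) (i k m : Fin n), ev z (w i * E k m - w k * E i m) =
        lower G U z i * electric G U z k m - lower G U z k * electric G U z i m :=
      fun z i k m => by simp only [map_sub, map_mul, ew, eE]
    have e4 := ev_cov3 (X := fun i k m => w i * E k m - w k * E i m)
      (X' := fun z i k m => lower G U z i * electric G U z k m
        - lower G U z k * electric G U z i m) eΓ e3
    simp only [hcard, map_add, map_sub, map_mul, map_ofNat, AlgHom.commutes, ev_dot, ev_tr,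
      ev_cov4 eΓ eC, ev_cov2 eΓ eE, e4, ew, eE, eg, eh, eu, ef] at e1
    exact e1
  · intro i k l m
    have e := S.dot_cov4_electric i k l m
    rw [← S.dot_cov4_kn_metric, ← S.dot_cov4_kn_velocity] at e
    have e1 := congrArg (ev ⟨y, hy⟩) e
    simp only [hcard, map_add, map_sub, map_mul, map_ofNat, AlgHom.commutes, ev_dot,
      ev_cov4 eΓ eC, ev_cov4 eΓ eknw, ev_cov4 eΓ ekng, eknw, ekng, eC, eu, ef] at e1
    exact e1

open scoped Manifold ContDiff Bundle

/-! ### Components in a chart: smoothness and nondegeneracy. -/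

section Charts

attribute [local instance 2000] chartedSpaceSelf

variable {n : ℕ} {M : Type*} [TopologicalSpace M] [ChartedSpace (Coord n) M]
  [IsManifold (𝓡 n) ∞ M] {e : OpenPartialHomeomorph M (Coord n)}

omit [IsManifold (𝓡 n) ∞ M] in
lemma mdifferentiable_of_mem_maximalAtlas (he : e ∈ IsManifold.maximalAtlas (𝓡 n) ∞ M) :
    e.MDifferentiable (𝓡 n) (𝓡 n) :=
  ⟨(contMDiffOn_of_mem_maximalAtlas he).mdifferentiableOn (by simp),
    (contMDiffOn_symm_of_mem_maximalAtlas he).mdifferentiableOn (by simp)⟩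

/-- A coordinate field is the image of a constant field under the tangent map of `e.symm`. -/
lemma contMDiffOn_coordVec (he : e ∈ IsManifold.maximalAtlas (𝓡 n) ∞ M) (i : Fin n) :
    ContMDiffOn (𝓡 n) (𝓡 n).tangent ∞
      (fun y => (⟨e.symm y, coordVec e y i⟩ : TangentBundle (𝓡 n) M)) e.target := by
  have h1 : ContMDiffOn (𝓡 n) (𝓡 n).tangent ∞
      (fun y : Coord n => (⟨y, (EuclideanSpace.single i 1 : Coord n)⟩ :
        TangentBundle (𝓡 n) (Coord n))) e.target := fun y _ =>
    contMDiffWithinAt_vectorSpace_iff_contDiffWithinAt.mpr contDiffWithinAt_const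
  have h2 := (contMDiffOn_symm_of_mem_maximalAtlas he).contMDiffOn_tangentMapWithin
    (m := ∞) (by simp) e.open_target.uniqueMDiffOn
  refine (h2.comp h1 fun y hy => hy).congr fun y hy => ?_
  simp only [Function.comp, tangentMapWithin, coordVec, mfderivWithin_of_isOpen e.open_target hy]

lemma contDiffOn_comp (g : LorentzMetric n M) (he : e ∈ IsManifold.maximalAtlas (𝓡 n) ∞ M)
    (i j : Fin n) : ContDiffOn ℝ ∞ (fun y => g.comp e y i j) e.target := by
  rw [← contMDiffOn_iff_contDiffOn]
  have h1 : ContMDiffOn (𝓡 n) ((𝓡 n).prod 𝓘(ℝ)) ∞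
      (fun y => Bundle.TotalSpace.mk' ℝ (E := Bundle.Trivial M ℝ) (e.symm y)
        (g.inner (e.symm y) (coordVec e y i) (coordVec e y j))) e.target := by
    apply ContMDiffOn.clm_bundle_apply₂ (F₁ := Coord n) (F₂ := Coord n)
    · exact g.contMDiff.comp_contMDiffOn (contMDiffOn_symm_of_mem_maximalAtlas he)
    · exact contMDiffOn_coordVec he i
    · exact contMDiffOn_coordVec he j
  intro y hy
  have h2 := h1 y hy
  simp only [Bundle.contMDiffWithinAt_totalSpace] at h2
  exact h2.2

lemma contDiffOn_vecComp {u : (x : M) → TangentSpace (𝓡 n) x}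
    (hu : ContMDiff (𝓡 n) (𝓡 n).tangent ∞ (fun x => (⟨x, u x⟩ : TangentBundle (𝓡 n) M)))
    (he : e ∈ IsManifold.maximalAtlas (𝓡 n) ∞ M) (i : Fin n) :
    ContDiffOn ℝ ∞ (fun y => vecComp u e y i) e.target := by
  have h1 := (contMDiffOn_of_mem_maximalAtlas he).contMDiffOn_tangentMapWithin
    (m := ∞) (by simp) e.open_source.uniqueMDiffOn
  have h2 := h1.comp (hu.comp_contMDiffOn (contMDiffOn_symm_of_mem_maximalAtlas he))
    fun y hy => e.map_target hy
  have h3 := (contMDiff_snd_tangentBundle_modelSpace (Coord n) (𝓡 n)).comp_contMDiffOn h2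
  rw [contMDiffOn_iff_contDiffOn] at h3
  have h4 := (EuclideanSpace.proj i : Coord n →L[ℝ] ℝ).contDiff.comp_contDiffOn h3
  refine h4.congr fun y hy => ?_
  simp only [Function.comp, tangentMapWithin, vecComp,
    mfderivWithin_of_isOpen e.open_source (e.map_target hy)]
  rfl

omit [IsManifold (𝓡 n) ∞ M] in
lemma contDiffOn_scalar {φ : M → ℝ} (hφ : ContMDiff (𝓡 n) 𝓘(ℝ) ∞ φ)
    (he : e ∈ IsManifold.maximalAtlas (𝓡 n) ∞ M) :
    ContDiffOn ℝ ∞ (fun y => φ (e.symm y)) e.target := by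
  rw [← contMDiffOn_iff_contDiffOn]
  exact hφ.comp_contMDiffOn (contMDiffOn_symm_of_mem_maximalAtlas he)

omit [IsManifold (𝓡 n) ∞ M] in
lemma mfderiv_symm_apply (y a : Coord n) :
    mfderiv (𝓡 n) (𝓡 n) e.symm y a = ∑ i, a i • coordVec e y i := by
  have h1 : a = ∑ i, a i • (EuclideanSpace.single i 1 : Coord n) := by
    ext j
    simp [Finset.sum_apply, Pi.single_apply]
  conv_lhs => rw [h1]
  exact (map_sum (mfderiv (𝓡 n) (𝓡 n) e.symm y) _ _).trans
    (Finset.sum_congr rfl fun i _ => map_smul _ _ _)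

omit [IsManifold (𝓡 n) ∞ M] in
/-- A vector field is the combination of the coordinate vectors given by its components. -/
lemma sum_vecComp_smul_coordVec (he : e ∈ IsManifold.maximalAtlas (𝓡 n) ∞ M) {y : Coord n}
    (hy : y ∈ e.target) (u : (x : M) → TangentSpace (𝓡 n) x) :
    ∑ i, vecComp u e y i • coordVec e y i = u (e.symm y) := by
  have h1 := (mdifferentiable_of_mem_maximalAtlas he).symm_comp_deriv (e.map_target hy)
  have h2 := DFunLike.congr_fun h1 (u (e.symm y))
  -- The chain rule gives the derivative of `e.symm` at `e (e.symm y)`, whose tangent space agrees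
  -- with that at `y` only after transport.
  have h3 : ∀ z, z = y → ∀ a : Coord n, (show Coord n from mfderiv (𝓡 n) (𝓡 n) e.symm z a) =
      (show Coord n from mfderiv (𝓡 n) (𝓡 n) e.symm y a) := by
    rintro z rfl a
    rfl
  exact (mfderiv_symm_apply y _).symm.trans ((h3 _ (e.right_inv hy) _).symm.trans h2)

omit [IsManifold (𝓡 n) ∞ M] in
lemma sum_smul_coordVec_injective (he : e ∈ IsManifold.maximalAtlas (𝓡 n) ∞ M) {y : Coord n}
    (hy : y ∈ e.target) (c : Fin n → ℝ) (hc : ∑ i, c i • coordVec e y i = 0) : c = 0 := by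
  have h1 := (mdifferentiable_of_mem_maximalAtlas he).comp_symm_deriv hy
  have h2 := DFunLike.congr_fun h1 (WithLp.toLp 2 c : Coord n)
  have h3 : mfderiv (𝓡 n) (𝓡 n) e.symm y (WithLp.toLp 2 c : Coord n) = 0 :=
    (mfderiv_symm_apply y _).trans hc
  have h4 : (0 : Coord n) = WithLp.toLp 2 c :=
    ((congrArg (mfderiv (𝓡 n) (𝓡 n) e (e.symm y)) h3).trans (map_zero _)).symm.trans h2
  exact (congrArg WithLp.ofLp h4).symm

lemma inner_sum_coordVec (g : LorentzMetric n M) (y : Coord n) (a b : Fin n → ℝ) :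
    g.inner (e.symm y) (∑ i, a i • coordVec e y i) (∑ j, b j • coordVec e y j) =
      ∑ i, a i * ∑ j, g.comp e y i j * b j := by
  simp only [map_sum, map_smul, sum_apply, smul_apply,
    smul_eq_mul, Finset.mul_sum, LorentzMetric.comp, Matrix.of_apply]
  rw [Finset.sum_comm]
  exact Finset.sum_congr rfl fun i _ => Finset.sum_congr rfl fun j _ => by ring

/-- A nonzero null vector of the Gram matrix would be orthogonal to everything: to `t`, so it has
positive square, and to itself, so its square is zero. -/
lemma isUnit_det_comp (g : LorentzMetric n M) (he : e ∈ IsManifold.maximalAtlas (𝓡 n) ∞ M)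
    {y : Coord n} (hy : y ∈ e.target) : IsUnit (g.comp e y).det := by
  rw [isUnit_iff_ne_zero]
  intro h0
  obtain ⟨c, hc, hGc⟩ := Matrix.exists_mulVec_eq_zero_iff.mpr h0
  obtain ⟨t, _, ht⟩ := g.lorentzian (e.symm y)
  have h1 : ∀ v, g.inner (e.symm y) v (∑ j, c j • coordVec e y j) = 0 := fun v => by
    classical
    -- The expansion is available for vector fields, so `v` is extended by zero away from its base
    -- point.
    have h2 := sum_vecComp_smul_coordVec he hy
      (fun x => if hx : x = e.symm y then hx ▸ v else 0)
    simp only [dite_true] at h2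
    rw [← h2, inner_sum_coordVec]
    exact Finset.sum_eq_zero fun i _ => by
      rw [show ∑ j, g.comp e y i j * c j = 0 from congrFun hGc i, mul_zero]
  have h2 := ht _ (h1 t) fun hV0 => hc (sum_smul_coordVec_injective he hy c hV0)
  exact absurd (h1 _) h2.ne'

end Charts

open CoordTensor in
theorem mainTheorem3 (n : ℕ) (hn : 3 < n) {M : Type*} [TopologicalSpace M]
    [ChartedSpace (Coord n) M] [IsManifold (𝓡 n) ∞ M]
    (g : LorentzMetric n M) (u : (x : M) → TangentSpace (𝓡 n) x) (φ : M → ℝ)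
    (h : IsTwisted g u φ)
    (e : OpenPartialHomeomorph M (Coord n)) (he : e ∈ IsManifold.maximalAtlas (𝓡 n) ∞ M)
    (y : Coord n) (hy : y ∈ e.target) :
    let G := g.comp e
    let U := vecComp u e
    let w := lower G U
    let C := weyl G
    let E := electric G U
    let f := φ (e.symm y)
    (∀ i k m : Fin n,
      div4 G C y i k m =
        ((n : ℝ) - 3) * (covD2 G E y i k m - covD2 G E y k i m)
        + ((n : ℝ) - 2) *
          (dirD3 G U (fun z i k m => w z i * E z k m - w z k * E z i m) y i k m
            + 2 * f * (w y i * E y k m - w y k * E y i m))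
        + (2 * w y k * w y m + G y k m) * div2 G E y i
        - (2 * w y i * w y m + G y i m) * div2 G E y k) ∧
    (∀ i k l m : Fin n,
      ((n : ℝ) - 3) * (dirD4 G U C y i k l m + 2 * f * C y i k l m) =
        ((n : ℝ) - 2) *
          (dirD4 G U (kulkarniNomizu (fun z a b => w z a * w z b) E) y i k l m
            + 2 * f * kulkarniNomizu (fun z a b => w z a * w z b) E y i k l m)
        + (dirD4 G U (kulkarniNomizu G E) y i k l m
            + 2 * f * kulkarniNomizu G E y i k l m)) :=
  weyl_identities_coord hn ⟨e.target, e.open_target⟩ (g.comp e) (vecComp u e)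
    (fun z => φ (e.symm z)) (contDiffOn_comp g he) (contDiffOn_vecComp h.smooth_velocity he)
    (contDiffOn_scalar h.smooth_scalar he) (fun z _ i j => g.symm _ _ _)
    (fun z hz => isUnit_det_comp g he hz)
    (fun z hz => by
      rw [← h.unit (e.symm z), ← sum_vecComp_smul_coordVec he hz u, inner_sum_coordVec]
      rfl)
    (fun z hz i j => h.torse_forming e he z hz i j) y hy
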